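/- Let $R$ be a commutative noetherian ring, and write $\otimes=\otimes_R$, $(-)^*=\mathrm{Hom}_R(-,R)$. A submodule $K\subseteq M$ is called pure if $K\otimes N\to M\otimes N$ is injective for every $R$-module $N$. A right-right entwining structure $(A,C,\psi)$ consists of an $R$-algebra $A$, an $R$-coalgebra $C$ and an $R$-linear map $\psi:C\otimes A\to A\otimes C$, $c\otimes a\mapsto\sum a_\psi\otimes c^\psi$, such that $$\textstyle\sum(ab)_\psi\otimes c^\psi=\sum a_\psi b_\Psi\otimes c^{\psi\Psi},\quad \sum 1_\psi\otimes c^\psi=1\otimes c,\quad \sum a_\psi\otimes\Delta(c^\psi)=\sum a_{\psi\Psi}\otimes c_1^\Psi\otimes c_2^\psi,\quad \sum\varepsilon(c^\psi)a_\psi=\varepsilon(c)a .$$ Its category $\mathcal M_A^C(\psi)$ of entwined modules has as objects the right $A$-modules $M$ that are also right $C$-comodules with $\varrho(ma)=\sum m_{<0>}a_\psi\otimes m_{<1>}^\psi$, and as morphisms the $A$-linear $C$-colinear maps. The ring $\#_\psi^{op}(C,A)$ is $\mathrm{Hom}_R(C,A)$ with $(f\cdot g)(c)=\sum f(c_2)_\psi\,g(c_1^\psi)$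 and unit $\eta_A\circ\varepsilon_C$; a right module over it is a right $A$-module along $a\mapsto\varepsilon_C(-)a$. The structure satisfies the $\alpha$-condition if for every right $A$-module $M$ the map $\alpha_M^\psi:M\otimes C\to\mathrm{Hom}_R(\#_\psi^{op}(C,A),M)$, $m\otimes c\mapsto[f\mapsto mf(c)]$, is injective; in that case a right $\#_\psi^{op}(C,A)$-module $M$ is called $\#$-rational if for every $m\in M$ the map $f\mapsto mf$ lies in the image of $\alpha_M^\psi$, and $\mathrm{Rat}^C(\mathcal M_{\#_\psi^{op}(C,A)})$ is the full subcategory of $\#$-rational modules. For a module $K$ over a ring, $\sigma[K]$ is the full subcategory of the modules that are isomorphic to a submodule of a quotient of a direct sum of copies of $K$. Let $(A,C,\psi)$ be a right-right entwining structure over $R$. Let $A^\circ=\{f\in A^*\mid AfA\text{ is finitely generated over }R\}$, where $(afb)(x)=f(bxa)$, and suppose that $A$ is an $\alpha$-algebra, i.e. $A^\circ\subseteq R^A$ is pure; then $A^\circ$ is an $R$-coalgebra with $\sum f_1(a)f_2(b)=f(ab)$ and $\varepsilon(f)=f(1)$. Let $\widetilde A\subseteq C^*$ be an $R$-subalgebra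 of the convolution algebra $C^*$ with $\varepsilon_C\in\widetilde A$, and let $\widetilde C\subseteq A^\circ$ be an $R$-subcoalgebra, i.e. a pure $R$-submodule with $\Delta(\widetilde C)\subseteq\widetilde C\otimes\widetilde C$. The canonical map $\widetilde A\otimes\widetilde C\to(C\otimes A)^*$ is then injective. Assume that $\psi^*:(A\otimes C)^*\to(C\otimes A)^*$ maps the image of $\widetilde C\otimes\widetilde A$ in $(A\otimes C)^*$ into the image of $\widetilde A\otimes\widetilde C$ in $(C\otimes A)^*$, and let $\varphi:\widetilde C\otimes\widetilde A\to\widetilde A\otimes\widetilde C$ be the induced $R$-linear map, so that the functional attached to $\varphi(\widetilde f\otimes\widetilde g)$ is $c\otimes a\mapsto\sum\widetilde f(a_\psi)\widetilde g(c^\psi)$. Then $(\widetilde A,\widetilde C,\varphi)$ is a right-right entwining structure which satisfies the $\alpha$-condition. Letting $f\in\#_\varphi^{op}(\widetilde C,\widetilde A)$ act on an entwined module $M$ by $mf=\sum m_{<0>}f(m_{<1>})$ (and leaving maps unchanged) defines an isomorphism of categories $$\mathcal M_{\widetilde A}^{\widetilde C}(\varphi)\simeq\mathrm{Rat}^{\widetilde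 C}(\mathcal M_{\#_\varphi^{op}(\widetilde C,\widetilde A)}),\qquad\text{and}\qquad \mathrm{Rat}^{\widetilde C}(\mathcal M_{\#_\varphi^{op}(\widetilde C,\widetilde A)})=\sigma[(\widetilde A\otimes\widetilde C)_{\#_\varphi^{op}(\widetilde C,\widetilde A)}],$$ where $\widetilde A\otimes\widetilde C$ is the entwined module with $(\widetilde g\otimes\widetilde f)\widetilde h=\sum\widetilde g\,\widetilde h_\varphi\otimes\widetilde f^\varphi$ and coaction $\mathrm{id}\otimes\Delta$, regarded as a right $\#_\varphi^{op}(\widetilde C,\widetilde A)$-module in this way. If moreover $\widetilde C$ is finitely generated projective over $R$, the same assignment is an isomorphism of categories $\mathcal M_{\widetilde A}^{\widetilde C}(\varphi)\simeq\mathcal M_{\#_\varphi^{op}(\widetilde C,\widetilde A)}$ onto the category of all right modules. -/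

import Mathlib

open TensorProduct

universe u

namespace DualEntwining

noncomputable section

/-! ### Pure submodules -/

/-- Purity in the sense of Cohn: `K ⊗ N → M ⊗ N` is injective for every `R`-module `N`. -/
def IsPureSubmodule {R M : Type u} [CommRing R] [AddCommGroup M] [Module R M]
    (K : Submodule R M) : Prop :=
  ∀ (N : Type u) [AddCommGroup N] [Module R N], Function.Injective (K.subtype.rTensor N)

section Separation

variable {R : Type u} [CommRing R]

/-- `g ↦ x ⊗ y ↦ g(y) x`: evaluation of the second tensor factor. -/
def evalRight (X : Type u) {Y : Type u} [AddCommGroup X] [Module R X] [AddCommGroup Y] [Module R Y]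
    (g : Module.Dual R Y) : X ⊗[R] Y →ₗ[R] X :=
  (TensorProduct.rid R X).toLinearMap ∘ₗ g.lTensor X

@[simp] theorem evalRight_tmul {X Y : Type u} [AddCommGroup X] [Module R X] [AddCommGroup Y]
    [Module R Y] (g : Module.Dual R Y) (x : X) (y : Y) :
    evalRight X g (x ⊗ₜ y) = g y • x := by
  simp [evalRight]

theorem evalRight_piProj {X W : Type u} [AddCommGroup X] [Module R X] [IsNoetherianRing R]
    (t : X ⊗[R] (W → R)) (h : ∀ w, evalRight X (LinearMap.proj w) t = 0) : t = 0 := by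
  obtain ⟨n, x, g, rfl⟩ := TensorProduct.exists_sum_tmul_eq t
  let L : (Fin n → R) →ₗ[R] X := Fintype.linearCombination R x
  obtain ⟨m, k, hk⟩ := Submodule.fg_iff_exists_fin_generating_family.1
    (IsNoetherian.noetherian (LinearMap.ker L))
  have hg : ∀ w, ∃ c : Fin m → R, ∑ j, c j • k j = fun i => g i w := by
    intro w
    have : (fun i => g i w) ∈ LinearMap.ker L := by
      rw [LinearMap.mem_ker, ← h w]
      simp [L, Fintype.linearCombination_apply]
    rw [← hk] at this
    exact (Submodule.mem_span_range_iff_exists_fun R).1 this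
  choose c hc using hg
  have hgi : ∀ i, g i = ∑ j, k j i • fun w => c w j := by
    intro i
    ext w
    have := congrFun (hc w) i
    simp only [Finset.sum_apply, Pi.smul_apply, smul_eq_mul] at this ⊢
    rw [← this]
    exact Finset.sum_congr rfl fun j _ => mul_comm _ _
  have hkj : ∀ j, ∑ i, k j i • x i = 0 := by
    intro j
    have : k j ∈ LinearMap.ker L := hk ▸ Submodule.subset_span ⟨j, rfl⟩
    simpa [L, Fintype.linearCombination_apply] using this
  simp_rw [hgi, TensorProduct.tmul_sum, TensorProduct.tmul_smul]
  rw [Finset.sum_comm]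
  simp_rw [TensorProduct.smul_tmul', ← TensorProduct.sum_tmul, hkj, TensorProduct.zero_tmul]
  simp

/-- A map `j : Y → R^W` is universally injective. -/
def IsPureMap {Y W : Type u} [AddCommGroup Y] [Module R Y] (j : Y →ₗ[R] (W → R)) : Prop :=
  ∀ (N : Type u) [AddCommGroup N] [Module R N], Function.Injective (j.rTensor N)

theorem IsPureMap.lTensor {Y Z : Type u} [AddCommGroup Y] [Module R Y] [AddCommGroup Z]
    [Module R Z] (j : Y →ₗ[R] Z) (N : Type u) [AddCommGroup N] [Module R N]
    (hj : Function.Injective (j.rTensor N)) : Function.Injective (j.lTensor N) := by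
  rw [← LinearMap.comm_comp_rTensor_comp_comm_eq]
  simpa using hj

theorem IsPureMap.eq_zero [IsNoetherianRing R] {X Y W : Type u} [AddCommGroup X] [Module R X]
    [AddCommGroup Y] [Module R Y] {j : Y →ₗ[R] (W → R)} (hj : IsPureMap j) (t : X ⊗[R] Y)
    (h : ∀ w, evalRight X (LinearMap.proj w ∘ₗ j) t = 0) : t = 0 := by
  refine (injective_iff_map_eq_zero _).1 (IsPureMap.lTensor j X (hj X)) t ?_
  refine evalRight_piProj _ fun w => ?_
  rw [← h w]
  simp [evalRight, LinearMap.lTensor_comp]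

/-- The canonical map `X ⊗ Y → (V ⊗ W)^*` attached to `X → V^*` and `Y → W^*`,
`(f ⊗ g)(v ⊗ w) = f(v) g(w)`. -/
def pairTensor {X Y V W : Type u} [AddCommGroup X] [Module R X] [AddCommGroup Y] [Module R Y]
    [AddCommGroup V] [Module R V] [AddCommGroup W] [Module R W]
    (i : X →ₗ[R] Module.Dual R V) (j : Y →ₗ[R] Module.Dual R W) :
    X ⊗[R] Y →ₗ[R] Module.Dual R (V ⊗[R] W) :=
  TensorProduct.dualDistrib R V W ∘ₗ TensorProduct.map i j

@[simp] theorem pairTensor_tmul {X Y V W : Type u} [AddCommGroup X] [Module R X] [AddCommGroup Y]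
    [Module R Y] [AddCommGroup V] [Module R V] [AddCommGroup W] [Module R W]
    (i : X →ₗ[R] Module.Dual R V) (j : Y →ₗ[R] Module.Dual R W) (x : X) (y : Y) (v : V) (w : W) :
    pairTensor i j (x ⊗ₜ y) (v ⊗ₜ w) = i x v * j y w := by
  simp [pairTensor]

theorem pairTensor_eq {X Y V W : Type u} [AddCommGroup X] [Module R X] [AddCommGroup Y]
    [Module R Y] [AddCommGroup V] [Module R V] [AddCommGroup W] [Module R W]
    (i : X →ₗ[R] Module.Dual R V) (j : Y →ₗ[R] Module.Dual R W) (t : X ⊗[R] Y) (v : V) (w : W) :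
    pairTensor i j t (v ⊗ₜ w) = i (evalRight X (LinearMap.applyₗ w ∘ₗ j) t) v := by
  induction t with
  | zero => simp
  | tmul x y => simp [mul_comm]
  | add s t hs ht => simp [hs, ht]

theorem pairTensor_injective [IsNoetherianRing R] {X Y V W : Type u} [AddCommGroup X] [Module R X]
    [AddCommGroup Y] [Module R Y] [AddCommGroup V] [Module R V] [AddCommGroup W] [Module R W]
    (i : X →ₗ[R] Module.Dual R V) (j : Y →ₗ[R] Module.Dual R W) (hi : Function.Injective i)
    (hj : IsPureMap (LinearMap.ltoFun R W R R ∘ₗ j)) : Function.Injective (pairTensor i j) := by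
  rw [injective_iff_map_eq_zero]
  intro t ht
  refine hj.eq_zero t fun w => ?_
  apply (injective_iff_map_eq_zero i).1 hi
  ext v
  have := pairTensor_eq i j t v w
  rw [ht] at this
  exact this.symm

/-- If `ι : Y → Z` is injective and the image of `g : X → Z` lies in that of `ι`, the unique
linear map `X → Y` through which `g` factors. -/
def factorThrough {X Y Z : Type u} [AddCommGroup X] [Module R X] [AddCommGroup Y] [Module R Y]
    [AddCommGroup Z] [Module R Z] (ι : Y →ₗ[R] Z) (hι : Function.Injective ι) (g : X →ₗ[R] Z)
    (hg : ∀ x, g x ∈ LinearMap.range ι) : X →ₗ[R] Y :=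
  (LinearEquiv.ofInjective ι hι).symm.toLinearMap ∘ₗ g.codRestrict (LinearMap.range ι) hg

@[simp] theorem factorThrough_spec {X Y Z : Type u} [AddCommGroup X] [Module R X] [AddCommGroup Y]
    [Module R Y] [AddCommGroup Z] [Module R Z] (ι : Y →ₗ[R] Z) (hι : Function.Injective ι)
    (g : X →ₗ[R] Z) (hg : ∀ x, g x ∈ LinearMap.range ι) (x : X) :
    ι (factorThrough ι hι g hg x) = g x := by
  have := LinearEquiv.apply_symm_apply (LinearEquiv.ofInjective ι hι)
    (g.codRestrict (LinearMap.range ι) hg x)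
  exact congrArg Subtype.val this

end Separation

/-! ### The finite dual of an algebra over a noetherian ring -/

section FiniteDual

variable (R A : Type u) [CommRing R] [Ring A] [Algebra R A]

/-- `A f A`, the sub-bimodule of `A^*` generated by `f`, for `(a f b)(x) = f(b x a)`. -/
def bimoduleSpan (f : Module.Dual R A) : Submodule R (Module.Dual R A) :=
  Submodule.span R (Set.range fun p : A × A =>
    f ∘ₗ LinearMap.mulLeft R p.2 ∘ₗ LinearMap.mulRight R p.1)

theorem mem_bimoduleSpan (f : Module.Dual R A) (a b : A) :
    f ∘ₗ LinearMap.mulLeft R b ∘ₗ LinearMap.mulRight R a ∈ bimoduleSpan R A f :=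
  Submodule.subset_span ⟨(a, b), rfl⟩

theorem fg_of_le_fg [IsNoetherianRing R] {M : Type u} [AddCommGroup M] [Module R M]
    {N P : Submodule R M} (h : N ≤ P) (hP : P.FG) : N.FG :=
  isNoetherian_submodule.1 (isNoetherian_of_fg_of_noetherian P hP) N h

/-- The finite dual `A° = {f ∈ A^* | A f A is finitely generated over R}`. -/
def finiteDual [IsNoetherianRing R] : Submodule R (Module.Dual R A) where
  carrier := {f | (bimoduleSpan R A f).FG}
  zero_mem' := by
    have : bimoduleSpan R A 0 = ⊥ := by
      simp [bimoduleSpan]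
    simpa [this] using Submodule.fg_bot
  add_mem' := by
    intro f g hf hg
    refine fg_of_le_fg R (Submodule.span_le.2 ?_) (Submodule.FG.sup hf hg)
    rintro _ ⟨p, rfl⟩
    exact Submodule.add_mem_sup (mem_bimoduleSpan R A f p.1 p.2) (mem_bimoduleSpan R A g p.1 p.2)
  smul_mem' := by
    intro r f hf
    refine fg_of_le_fg R (Submodule.span_le.2 ?_) hf
    rintro _ ⟨p, rfl⟩
    exact Submodule.smul_mem _ r (mem_bimoduleSpan R A f p.1 p.2)

/-- An algebra over a noetherian ring is an `α`-algebra if `A° ⊆ R^A` is pure. -/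
class IsAlphaAlgebra [IsNoetherianRing R] : Prop where
  pure : IsPureSubmodule ((finiteDual R A).map (LinearMap.ltoFun R A R R))

variable [IsNoetherianRing R]

theorem mem_finiteDual_bimodule {f : Module.Dual R A} (hf : f ∈ finiteDual R A) (a b : A) :
    f ∘ₗ LinearMap.mulLeft R b ∘ₗ LinearMap.mulRight R a ∈ finiteDual R A := by
  refine fg_of_le_fg R (Submodule.span_le.2 ?_) hf
  rintro _ ⟨p, rfl⟩
  refine Submodule.subset_span ⟨(p.1 * a, b * p.2), ?_⟩
  ext x
  simp [mul_assoc]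

/-- The finite dual as a type. -/
def FiniteDual : Type u := finiteDual R A

instance : AddCommGroup (FiniteDual R A) := inferInstanceAs (AddCommGroup (finiteDual R A))

instance : Module R (FiniteDual R A) := inferInstanceAs (Module R (finiteDual R A))

/-- The inclusion `A° → A^*`. -/
def FiniteDual.incl : FiniteDual R A →ₗ[R] Module.Dual R A := (finiteDual R A).subtype

theorem FiniteDual.incl_injective : Function.Injective (FiniteDual.incl R A) :=
  Subtype.val_injective

/-- The functional `x ↦ f(b x a)`. -/
def FiniteDual.bimod (f : FiniteDual R A) (a b : A) : FiniteDual R A :=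
  ⟨FiniteDual.incl R A f ∘ₗ LinearMap.mulLeft R b ∘ₗ LinearMap.mulRight R a,
    mem_finiteDual_bimodule R A f.2 a b⟩

@[simp] theorem FiniteDual.incl_bimod (f : FiniteDual R A) (a b x : A) :
    FiniteDual.incl R A (f.bimod R A a b) x = FiniteDual.incl R A f (b * (x * a)) := rfl

theorem finiteDual_isPureMap [IsAlphaAlgebra R A] :
    IsPureMap (LinearMap.ltoFun R A R R ∘ₗ FiniteDual.incl R A) := by
  intro N _ _
  have hinj : Function.Injective (LinearMap.ltoFun R A R R) := DFunLike.coe_injective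
  let e : FiniteDual R A ≃ₗ[R] (finiteDual R A).map (LinearMap.ltoFun R A R R) :=
    (finiteDual R A).equivMapOfInjective _ hinj
  have he : LinearMap.ltoFun R A R R ∘ₗ FiniteDual.incl R A =
      ((finiteDual R A).map (LinearMap.ltoFun R A R R)).subtype ∘ₗ e.toLinearMap := by
    ext x; rfl
  rw [he, LinearMap.rTensor_comp, LinearMap.coe_comp]
  exact (IsAlphaAlgebra.pure N).comp (LinearEquiv.rTensor N e).injective

/-- The canonical embedding `A° ⊗ A° → (A ⊗ A)^*`. -/
def finiteDualPair : FiniteDual R A ⊗[R] FiniteDual R A →ₗ[R] Module.Dual R (A ⊗[R] A) :=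
  pairTensor (FiniteDual.incl R A) (FiniteDual.incl R A)

theorem finiteDualPair_injective [IsAlphaAlgebra R A] :
    Function.Injective (finiteDualPair R A) :=
  pairTensor_injective _ _ (FiniteDual.incl_injective R A) (finiteDual_isPureMap R A)

theorem finiteDual_comul_exists [IsAlphaAlgebra R A] (f : FiniteDual R A) :
    ((LinearMap.mul' R A).dualMap ∘ₗ FiniteDual.incl R A) f ∈
      LinearMap.range (finiteDualPair R A) := by
  let j := LinearMap.ltoFun R A R R ∘ₗ FiniteDual.incl R A
  let F : A → FiniteDual R A := fun b => f.bimod R A b 1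
  have hfg : (Submodule.span R (Set.range F)).FG := by
    refine Submodule.fg_of_fg_map_injective (FiniteDual.incl R A) (FiniteDual.incl_injective R A) ?_
    refine fg_of_le_fg R ?_ f.2
    rw [Submodule.map_span, Submodule.span_le]
    rintro _ ⟨_, ⟨b, rfl⟩, rfl⟩
    exact mem_bimoduleSpan R A (FiniteDual.incl R A f) b 1
  obtain ⟨n, m, hm⟩ := Submodule.fg_iff_exists_fin_generating_family.1 hfg
  have hF : ∀ b, ∃ c : Fin n → R, ∑ k, c k • m k = F b := fun b =>
    (Submodule.mem_span_range_iff_exists_fun R).1 (hm ▸ Submodule.subset_span ⟨b, rfl⟩)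
  choose g hg using hF
  have hgab : ∀ a b, ∑ k, g b k * FiniteDual.incl R A (m k) a = FiniteDual.incl R A f (a * b) := by
    intro a b
    have := congrArg (fun h : FiniteDual R A => FiniteDual.incl R A h a) (hg b)
    simp only [map_sum, map_smul, LinearMap.sum_apply, LinearMap.smul_apply, smul_eq_mul] at this
    simpa [F] using this
  let u : FiniteDual R A ⊗[R] (A → R) := ∑ k, m k ⊗ₜ fun b => g b k
  let q := (LinearMap.range j).mkQ
  have hu : q.lTensor (FiniteDual R A) u = 0 := by
    refine (injective_iff_map_eq_zero _).1 (finiteDual_isPureMap R A _) _ ?_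
    refine (TensorProduct.comm R _ _).injective ?_
    rw [map_zero]
    refine evalRight_piProj _ fun a => ?_
    have : q (j (f.bimod R A 1 a)) = 0 :=
      (Submodule.Quotient.mk_eq_zero _).2 ⟨_, rfl⟩
    rw [← this]
    simp only [u, map_sum, LinearMap.lTensor_tmul, LinearMap.rTensor_tmul,
      TensorProduct.comm_tmul, evalRight_tmul, ← map_smul]
    rw [← map_sum]
    congr 1
    ext b
    simpa [j, mul_comm] using hgab a b
  obtain ⟨t, ht⟩ := (lTensor_exact (FiniteDual R A) (f := j) (g := q)
    (LinearMap.exact_map_mkQ_range j) (Submodule.mkQ_surjective _) u).1 hu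
  refine ⟨t, ?_⟩
  ext a b
  have h1 : ∀ b, evalRight (FiniteDual R A) (LinearMap.applyₗ b ∘ₗ FiniteDual.incl R A) t =
      F b := by
    intro b
    have : evalRight (FiniteDual R A) (LinearMap.proj b) (j.lTensor (FiniteDual R A) t) = F b := by
      rw [ht, ← hg b]
      simp [u]
    rw [← this]
    simp only [evalRight, LinearMap.comp_apply, ← LinearMap.lTensor_comp_apply]
    rfl
  have := pairTensor_eq (FiniteDual.incl R A) (FiniteDual.incl R A) t a b
  rw [h1] at this
  simpa [F, finiteDualPair] using this

/-- The comultiplication of `A°`: the dual of the multiplication of `A`,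
`∑ f₁(a) f₂(b) = f(ab)`. -/
def finiteDualComul [IsAlphaAlgebra R A] :
    FiniteDual R A →ₗ[R] FiniteDual R A ⊗[R] FiniteDual R A :=
  factorThrough (finiteDualPair R A) (finiteDualPair_injective R A)
    ((LinearMap.mul' R A).dualMap ∘ₗ FiniteDual.incl R A) (finiteDual_comul_exists R A)

theorem finiteDualPair_comul [IsAlphaAlgebra R A] (f : FiniteDual R A) (a b : A) :
    finiteDualPair R A (finiteDualComul R A f) (a ⊗ₜ b) = FiniteDual.incl R A f (a * b) := by
  simp [finiteDualComul]

/-- Evaluation at `1`. -/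
def finiteDualCounit : FiniteDual R A →ₗ[R] R :=
  LinearMap.applyₗ 1 ∘ₗ FiniteDual.incl R A

theorem finiteDual_eq_zero [IsAlphaAlgebra R A] {X : Type u} [AddCommGroup X] [Module R X]
    (t : X ⊗[R] FiniteDual R A)
    (h : ∀ a, evalRight X (LinearMap.applyₗ a ∘ₗ FiniteDual.incl R A) t = 0) : t = 0 :=
  (finiteDual_isPureMap R A).eq_zero t h

/-- `A°` is a coalgebra when `A` is an `α`-algebra over a noetherian ring. -/
instance finiteDualCoalgebra [IsAlphaAlgebra R A] : Coalgebra R (FiniteDual R A) where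
  comul := finiteDualComul R A
  counit := finiteDualCounit R A
  coassoc := by
    ext1 f
    apply (TensorProduct.assoc R _ _ _).symm.injective
    rw [← sub_eq_zero]
    refine finiteDual_eq_zero R A _ fun c => ?_
    apply finiteDualPair_injective R A
    ext a b
    have hB : ∀ (x : FiniteDual R A) (t : FiniteDual R A ⊗[R] FiniteDual R A),
        finiteDualPair R A (evalRight _ (LinearMap.applyₗ c ∘ₗ FiniteDual.incl R A)
          ((TensorProduct.assoc R _ _ _).symm (x ⊗ₜ t))) (a ⊗ₜ b) =
        FiniteDual.incl R A x a * finiteDualPair R A t (b ⊗ₜ c) := by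
      intro x t
      induction t with
      | zero => simp
      | tmul y z => simp [finiteDualPair]; ring
      | add s t hs ht => simp [tmul_add, mul_add, hs, ht]
    have h1 : ∀ s : FiniteDual R A ⊗[R] FiniteDual R A,
        finiteDualPair R A (evalRight _ (LinearMap.applyₗ c ∘ₗ FiniteDual.incl R A)
          ((finiteDualComul R A).rTensor _ s)) (a ⊗ₜ b) =
        finiteDualPair R A s ((a * b) ⊗ₜ c) := by
      intro s
      induction s with
      | zero => simp
      | tmul y z => simp [finiteDualPair_comul]; simp [finiteDualPair, mul_comm]
      | add s t hs ht => simp [hs, ht]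
    have h2 : ∀ s : FiniteDual R A ⊗[R] FiniteDual R A,
        finiteDualPair R A (evalRight _ (LinearMap.applyₗ c ∘ₗ FiniteDual.incl R A)
          ((TensorProduct.assoc R _ _ _).symm ((finiteDualComul R A).lTensor _ s))) (a ⊗ₜ b) =
        finiteDualPair R A s (a ⊗ₜ (b * c)) := by
      intro s
      induction s with
      | zero => simp
      | tmul y z => simp [hB, finiteDualPair_comul]; simp [finiteDualPair]
      | add s t hs ht => simp [hs, ht]
    simp [h1, h2, finiteDualPair_comul, mul_assoc]
  rTensor_counit_comp_comul := by
    ext1 f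
    rw [← sub_eq_zero]
    refine finiteDual_eq_zero R A _ fun c => ?_
    have h := finiteDualPair_comul R A f 1 c
    have : ∀ t : FiniteDual R A ⊗[R] FiniteDual R A, 
       evalRight R (LinearMap.applyₗ c ∘ₗ FiniteDual.incl R A) 
         ((finiteDualCounit R A).rTensor _ t) = finiteDualPair R A t (1 ⊗ₜ c) := by
      intro t
      induction t with
      | zero => simp
      | tmul x y => simp [finiteDualPair, finiteDualCounit, mul_comm]
      | add s t hs ht => simp [hs, ht]
    simp [this, h]
  lTensor_counit_comp_comul := by
    ext1 f
    apply (TensorProduct.rid R _).injective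
    apply FiniteDual.incl_injective R A
    ext c
    have h := finiteDualPair_comul R A f c 1
    have : ∀ t : FiniteDual R A ⊗[R] FiniteDual R A, 
       FiniteDual.incl R A (TensorProduct.rid R _ ((finiteDualCounit R A).lTensor _ t)) c 
         = finiteDualPair R A t (c ⊗ₜ 1) := by
      intro t
      induction t with
      | zero => simp
      | tmul x y => simp [finiteDualPair, finiteDualCounit, mul_comm]
      | add s t hs ht => simp [hs, ht]
    simp [this, h]

end FiniteDual

/-! ### Subcoalgebras -/

/-- A subcoalgebra of a coalgebra over a commutative ring: a pure submodule `D ⊆ C`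
(so that `D ⊗ D ⊆ C ⊗ C`) with `Δ(D) ⊆ D ⊗ D`. -/
structure Subcoalgebra (R C : Type u) [CommRing R] [AddCommGroup C] [Module R C]
    [Coalgebra R C] where
  toSubmodule : Submodule R C
  pure : IsPureSubmodule toSubmodule
  comul_mem : ∀ d ∈ toSubmodule, (CoalgebraStruct.comul d : C ⊗[R] C) ∈
    LinearMap.range (TensorProduct.map toSubmodule.subtype toSubmodule.subtype)

namespace Subcoalgebra

variable {R C : Type u} [CommRing R] [AddCommGroup C] [Module R C] [Coalgebra R C]

/-- The underlying type of a subcoalgebra. -/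
def Carrier (D : Subcoalgebra R C) : Type u := D.toSubmodule

instance : CoeSort (Subcoalgebra R C) (Type u) := ⟨Carrier⟩

variable (D : Subcoalgebra R C)

instance : AddCommGroup D := inferInstanceAs (AddCommGroup D.toSubmodule)

instance : Module R D := inferInstanceAs (Module R D.toSubmodule)

/-- The inclusion of a subcoalgebra. -/
def incl : D →ₗ[R] C := D.toSubmodule.subtype

theorem incl_injective : Function.Injective D.incl := Subtype.val_injective

theorem rTensor_incl_injective (N : Type u) [AddCommGroup N] [Module R N] :
    Function.Injective (D.incl.rTensor N) := D.pure N

theorem lTensor_incl_injective (N : Type u) [AddCommGroup N] [Module R N] :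
    Function.Injective (D.incl.lTensor N) := IsPureMap.lTensor _ _ (D.rTensor_incl_injective N)

theorem lTensor_lTensor_incl_injective (M N : Type u) [AddCommGroup M] [Module R M]
    [AddCommGroup N] [Module R N] :
    Function.Injective ((D.incl.lTensor N).lTensor M) := by
  have h : (D.incl.lTensor N).lTensor M = (TensorProduct.assoc R M N C).toLinearMap ∘ₗ
      D.incl.lTensor (M ⊗[R] N) ∘ₗ (TensorProduct.assoc R M N D).symm.toLinearMap := by
    ext; simp
  rw [h]
  simpa using D.lTensor_incl_injective (M ⊗[R] N)

theorem lTensor_rTensor_incl_injective (M N : Type u) [AddCommGroup M] [Module R M]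
    [AddCommGroup N] [Module R N] :
    Function.Injective ((D.incl.rTensor N).lTensor M) := by
  have h : (D.incl.rTensor N).lTensor M =
      ((TensorProduct.comm R N C).lTensor M).toLinearMap ∘ₗ
      (D.incl.lTensor N).lTensor M ∘ₗ ((TensorProduct.comm R D N).lTensor M).toLinearMap := by
    ext; simp
  rw [h, LinearMap.coe_comp, LinearMap.coe_comp]
  exact (LinearEquiv.injective _).comp
    ((D.lTensor_lTensor_incl_injective M N).comp (LinearEquiv.injective _))

theorem map_incl_injective : Function.Injective (TensorProduct.map D.incl D.incl) := by
  rw [← LinearMap.lTensor_comp_rTensor, LinearMap.coe_comp]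
  exact (D.lTensor_incl_injective C).comp (D.rTensor_incl_injective D)

/-- The restricted comultiplication. -/
def comul : D →ₗ[R] D ⊗[R] D :=
  factorThrough (TensorProduct.map D.incl D.incl) D.map_incl_injective
    (CoalgebraStruct.comul ∘ₗ D.incl) (fun d => D.comul_mem (D.incl d) d.2)

theorem map_incl_comul (d : D) :
    TensorProduct.map D.incl D.incl (D.comul d) = CoalgebraStruct.comul (D.incl d) :=
  factorThrough_spec _ D.map_incl_injective _ _ d

/-- A subcoalgebra is a coalgebra, with the structure induced from the ambient one. -/
instance : Coalgebra R D where
  comul := D.comul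
  counit := CoalgebraStruct.counit ∘ₗ D.incl
  coassoc := by
    ext1 d
    have hinj : Function.Injective
        (TensorProduct.map D.incl (TensorProduct.map D.incl D.incl)) := by
      rw [← LinearMap.lTensor_comp_rTensor, LinearMap.coe_comp]
      refine Function.Injective.comp ?_ (D.rTensor_incl_injective _)
      rw [← LinearMap.lTensor_comp_rTensor, LinearMap.lTensor_comp, LinearMap.coe_comp]
      refine Function.Injective.comp ?_ ?_
      · exact D.lTensor_lTensor_incl_injective C C
      · exact D.lTensor_rTensor_incl_injective C D
    apply hinj
    have h1 : ∀ s : D ⊗[R] D, TensorProduct.map D.incl (TensorProduct.map D.incl D.incl)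
        (TensorProduct.assoc R _ _ _ (D.comul.rTensor _ s)) =
        TensorProduct.assoc R _ _ _ ((CoalgebraStruct.comul (R := R) (A := C)).rTensor C
          (TensorProduct.map D.incl D.incl s)) := by
      intro s
      rw [TensorProduct.map_map_assoc]
      congr 1
      induction s with
      | zero => simp
      | tmul x y => simp [map_incl_comul]
      | add s t hs ht => simp only [map_add, hs, ht]
    have h2 : ∀ s : D ⊗[R] D, TensorProduct.map D.incl (TensorProduct.map D.incl D.incl)
        (D.comul.lTensor _ s) = (CoalgebraStruct.comul (R := R) (A := C)).lTensor C
          (TensorProduct.map D.incl D.incl s) := by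
      intro s
      induction s with
      | zero => simp
      | tmul x y => simp [map_incl_comul]
      | add s t hs ht => simp only [map_add, hs, ht]
    simp only [LinearMap.comp_apply, LinearEquiv.coe_coe]
    rw [h1, h2, map_incl_comul]
    exact Coalgebra.coassoc_apply _
  rTensor_counit_comp_comul := by
    ext1 d
    apply D.lTensor_incl_injective R
    have : ∀ s : D ⊗[R] D, D.incl.lTensor R ((CoalgebraStruct.counit ∘ₗ D.incl).rTensor _ s) =
        (CoalgebraStruct.counit (R := R) (A := C)).rTensor C (TensorProduct.map D.incl D.incl s) := by
      intro s
      induction s with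
      | zero => simp
      | tmul x y => simp
      | add s t hs ht => simp only [map_add, hs, ht]
    simp [this, map_incl_comul]
  lTensor_counit_comp_comul := by
    ext1 d
    apply D.rTensor_incl_injective R
    have : ∀ s : D ⊗[R] D, D.incl.rTensor R ((CoalgebraStruct.counit ∘ₗ D.incl).lTensor _ s) =
        (CoalgebraStruct.counit (R := R) (A := C)).lTensor C (TensorProduct.map D.incl D.incl s) := by
      intro s
      induction s with
      | zero => simp
      | tmul x y => simp
      | add s t hs ht => simp only [map_add, hs, ht]
    simp [this, map_incl_comul]

end Subcoalgebra

/-! ### Entwining structures and entwined modules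

Right `A`-modules are modules over `Aᵐᵒᵖ`: `m a` is `MulOpposite.op a • m`. -/

section Entwining

open MulOpposite CategoryTheory

/-- The right action of `A` on `M` as a linear map `M ⊗ A → M`. -/
def rightAct (R A M : Type u) [CommRing R] [Ring A] [Algebra R A] [AddCommGroup M] [Module R M]
    [Module Aᵐᵒᵖ M] [IsScalarTower R Aᵐᵒᵖ M] : M ⊗[R] A →ₗ[R] M :=
  TensorProduct.lift (LinearMap.mk₂ R (fun m a => op a • m)
    (fun m n a => smul_add _ m n) (fun r m a => smul_comm _ r m)
    (fun m a b => by rw [MulOpposite.op_add, add_smul])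
    (fun r m a => by rw [MulOpposite.op_smul, smul_assoc]))

@[simp] theorem rightAct_tmul (R A M : Type u) [CommRing R] [Ring A] [Algebra R A]
    [AddCommGroup M] [Module R M] [Module Aᵐᵒᵖ M] [IsScalarTower R Aᵐᵒᵖ M] (m : M) (a : A) :
    rightAct R A M (m ⊗ₜ a) = op a • m := by
  simp [rightAct]

/-- A right-right entwining structure `(A, C, ψ)` over `R`, `ψ (c ⊗ a) = ∑ a_ψ ⊗ c^ψ`. -/
structure EntwiningStructure (R A C : Type u) [CommRing R] [Ring A] [Algebra R A]
    [AddCommGroup C] [Module R C] [Coalgebra R C] where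
  /-- the entwining map `ψ` -/
  ψ : C ⊗[R] A →ₗ[R] A ⊗[R] C
  /-- `∑ (ab)_ψ ⊗ c^ψ = ∑ a_ψ b_Ψ ⊗ c^{ψΨ}` -/
  ψ_mul : ∀ (c : C) (a b : A), ψ (c ⊗ₜ (a * b)) =
    (LinearMap.mul' R A).rTensor C ((TensorProduct.assoc R A A C).symm
      (ψ.lTensor A (TensorProduct.assoc R A C A (ψ (c ⊗ₜ a) ⊗ₜ b))))
  /-- `∑ 1_ψ ⊗ c^ψ = 1 ⊗ c` -/
  ψ_one : ∀ c : C, ψ (c ⊗ₜ 1) = 1 ⊗ₜ c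
  /-- `∑ a_ψ ⊗ Δ(c^ψ) = ∑ a_{ψΨ} ⊗ c₁^Ψ ⊗ c₂^ψ` -/
  ψ_comul : ∀ (c : C) (a : A), CoalgebraStruct.comul.lTensor A (ψ (c ⊗ₜ a)) =
    TensorProduct.assoc R A C C (ψ.rTensor C ((TensorProduct.assoc R C A C).symm
      (ψ.lTensor C (TensorProduct.assoc R C C A (CoalgebraStruct.comul c ⊗ₜ a)))))
  /-- `∑ ε(c^ψ) a_ψ = ε(c) a` -/
  ψ_counit : ∀ (c : C) (a : A),
    TensorProduct.rid R A (CoalgebraStruct.counit.lTensor A (ψ (c ⊗ₜ a))) =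
      (CoalgebraStruct.counit c : R) • a

variable {R A C : Type u} [CommRing R] [Ring A] [Algebra R A] [AddCommGroup C] [Module R C]
  [Coalgebra R C] (E : EntwiningStructure R A C)

/-- For a right `A`-module `M`, the map `(m ⊗ c) ⊗ a ↦ ∑ m a_ψ ⊗ c^ψ`. -/
def twist (M : Type u) [AddCommGroup M] [Module R M] [Module Aᵐᵒᵖ M] [IsScalarTower R Aᵐᵒᵖ M] :
    (M ⊗[R] C) ⊗[R] A →ₗ[R] M ⊗[R] C :=
  (rightAct R A M).rTensor C ∘ₗ (TensorProduct.assoc R M A C).symm.toLinearMap ∘ₗ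
    E.ψ.lTensor M ∘ₗ (TensorProduct.assoc R M C A).toLinearMap

/-- A right-right entwined module: a right `A`-module and right `C`-comodule `M` with
`ϱ(ma) = ∑ m₀ a_ψ ⊗ m₁^ψ`. -/
structure EntwinedModule where
  carrier : Type u
  [addCommGroup : AddCommGroup carrier]
  [module : Module R carrier]
  [rightModule : Module Aᵐᵒᵖ carrier]
  [isScalarTower : IsScalarTower R Aᵐᵒᵖ carrier]
  /-- the coaction `ϱ` -/
  coact : carrier →ₗ[R] carrier ⊗[R] C
  coact_coassoc : ∀ m, TensorProduct.assoc R carrier C C (coact.rTensor C (coact m)) =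
    CoalgebraStruct.comul.lTensor carrier (coact m)
  coact_counit : ∀ m,
    TensorProduct.rid R carrier (CoalgebraStruct.counit.lTensor carrier (coact m)) = m
  coact_smul : ∀ (m : carrier) (a : A), coact (op a • m) = twist E carrier (coact m ⊗ₜ a)

namespace EntwinedModule

attribute [instance] addCommGroup module rightModule isScalarTower

variable {E}

instance : CoeSort (EntwinedModule E) (Type u) := ⟨carrier⟩

/-- `A`-linear `C`-colinear maps. -/
@[ext]
structure Hom (M N : EntwinedModule E) where
  toLinearMap : M →ₗ[R] N
  map_smul : ∀ (a : A) (m : M), toLinearMap (op a • m) = op a • toLinearMap m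
  map_coact : ∀ m : M, N.coact (toLinearMap m) = toLinearMap.rTensor C (M.coact m)

/-- The category `M_A^C(ψ)` of entwined modules. -/
instance : CategoryTheory.Category (EntwinedModule E) where
  Hom := Hom
  id M := ⟨LinearMap.id, fun _ _ => rfl, fun m => by simp⟩
  comp f g := ⟨g.toLinearMap ∘ₗ f.toLinearMap, fun a m => by simp [f.map_smul, g.map_smul],
    fun m => by simp [f.map_coact, g.map_coact, LinearMap.rTensor_comp]⟩

/-- The endomorphism `m ↦ ∑ m₀ f(m₁)` attached to `f ∈ Hom_R(C, A)`. -/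
def actBy (M : EntwinedModule E) (f : C →ₗ[R] A) : M →ₗ[R] M :=
  rightAct R A M ∘ₗ f.lTensor M ∘ₗ M.coact

end EntwinedModule

section Induced

variable (M : Type u) [AddCommGroup M] [Module R M] [Module Aᵐᵒᵖ M] [IsScalarTower R Aᵐᵒᵖ M]

theorem twist_tmul_one (t : M ⊗[R] C) : twist E M (t ⊗ₜ (1 : A)) = t := by
  induction t with
  | zero => simp
  | tmul m c => simp [twist, E.ψ_one]
  | add s t hs ht => simp [add_tmul, hs, ht]

set_option linter.unusedSectionVars false

/-- `a ⊗ c ↦ m a ⊗ c`. -/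
def actOn (m : M) : A ⊗[R] C →ₗ[R] M ⊗[R] C :=
  ((rightAct R A M) ∘ₗ TensorProduct.mk R M A m).rTensor C

@[simp] theorem actOn_tmul (m : M) (a : A) (c : C) :
    actOn M m (a ⊗ₜ[R] c) = (op a • m) ⊗ₜ[R] c := by
  simp [actOn]

theorem twist_tmul_tmul (m : M) (c : C) (a : A) :
    twist E M ((m ⊗ₜ c) ⊗ₜ a) = actOn M m (E.ψ (c ⊗ₜ a)) := by
  simp only [twist, LinearMap.comp_apply, LinearEquiv.coe_coe, TensorProduct.assoc_tmul,
    LinearMap.lTensor_tmul]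
  induction E.ψ (c ⊗ₜ a) with
  | zero => simp
  | tmul x y => simp
  | add s t hs ht => simp [tmul_add, hs, ht]

theorem twist_twist (t : M ⊗[R] C) (a b : A) :
    twist E M (twist E M (t ⊗ₜ a) ⊗ₜ b) = twist E M (t ⊗ₜ (a * b)) := by
  induction t with
  | zero => simp
  | add s t hs ht => simp only [add_tmul, map_add, hs, ht]
  | tmul m c =>
    rw [twist_tmul_tmul, twist_tmul_tmul, E.ψ_mul]
    induction E.ψ (c ⊗ₜ a) with
    | zero => simp
    | add s t hs ht => simp only [add_tmul, map_add, hs, ht]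
    | tmul x y =>
      simp only [actOn_tmul, twist_tmul_tmul, TensorProduct.assoc_tmul, LinearMap.lTensor_tmul]
      induction E.ψ (y ⊗ₜ b) with
      | zero => simp
      | add s t hs ht => simp only [tmul_add, map_add, hs, ht]
      | tmul z w => simp [mul_smul]

/-- `M ⊗ C` for a right `A`-module `M`, with the right `A`-action
`(m ⊗ c) a = ∑ m a_ψ ⊗ c^ψ`. -/
def InducedCarrier (_E : EntwiningStructure R A C) (M : Type u) [AddCommGroup M] [Module R M] :
    Type u := M ⊗[R] C

instance : AddCommGroup (InducedCarrier E M) := inferInstanceAs (AddCommGroup (M ⊗[R] C))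

instance : Module R (InducedCarrier E M) := inferInstanceAs (Module R (M ⊗[R] C))

/-- The identity `M ⊗ C → M ⊗ C`, viewed as a map to `InducedCarrier E M`. -/
def toInduced : M ⊗[R] C ≃ₗ[R] InducedCarrier E M := LinearEquiv.refl R (M ⊗[R] C)

instance : Module Aᵐᵒᵖ (InducedCarrier E M) where
  smul a t := twist E M ((show M ⊗[R] C from t) ⊗ₜ a.unop)
  one_smul t := twist_tmul_one E M t
  mul_smul a b t := (twist_twist E M t b.unop a.unop).symm
  smul_zero a := by
    change twist E M ((0 : M ⊗[R] C) ⊗ₜ a.unop) = 0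
    simp
  smul_add a s t := by
    change twist E M (((show M ⊗[R] C from s) + (show M ⊗[R] C from t)) ⊗ₜ a.unop) = _
    rw [add_tmul, map_add]
    rfl
  add_smul a b t := by
    change twist E M ((show M ⊗[R] C from t) ⊗ₜ (a.unop + b.unop)) = _
    rw [tmul_add, map_add]
    rfl
  zero_smul t := by
    change twist E M ((show M ⊗[R] C from t) ⊗ₜ (0 : A)) = 0
    rw [tmul_zero, map_zero]

theorem smul_toInduced (a : A) (t : M ⊗[R] C) :
    op a • toInduced E M t = toInduced E M (twist E M (t ⊗ₜ a)) := rfl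

instance : IsScalarTower R Aᵐᵒᵖ (InducedCarrier E M) where
  smul_assoc r a t := by
    change twist E M ((show M ⊗[R] C from t) ⊗ₜ (r • a.unop)) = _
    rw [tmul_smul, map_smul]
    rfl

/-- `m ⊗ c ↦ ∑ (m ⊗ c₁) ⊗ c₂`. -/
def inducedCoact (R C M : Type u) [CommRing R] [AddCommGroup C] [Module R C] [Coalgebra R C]
    [AddCommGroup M] [Module R M] : M ⊗[R] C →ₗ[R] (M ⊗[R] C) ⊗[R] C :=
  (TensorProduct.assoc R M C C).symm.toLinearMap ∘ₗ CoalgebraStruct.comul.lTensor M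

theorem inducedCoact_tmul (m : M) (c : C) : inducedCoact R C M (m ⊗ₜ c) =
    (TensorProduct.assoc R M C C).symm (m ⊗ₜ CoalgebraStruct.comul c) := by
  simp [inducedCoact]

theorem inducedCoact_coassoc (t : M ⊗[R] C) :
    TensorProduct.assoc R (M ⊗[R] C) C C
      ((inducedCoact R C M).rTensor C (inducedCoact R C M t)) =
    CoalgebraStruct.comul.lTensor (M ⊗[R] C) (inducedCoact R C M t) := by
  induction t with
  | zero => simp
  | add s t hs ht => simp only [map_add, hs, ht]
  | tmul m c =>
    have h1 : ∀ s : C ⊗[R] C, TensorProduct.assoc R (M ⊗[R] C) C C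
        ((inducedCoact R C M).rTensor C ((TensorProduct.assoc R M C C).symm (m ⊗ₜ s))) =
        (TensorProduct.assoc R M C (C ⊗[R] C)).symm (m ⊗ₜ
          TensorProduct.assoc R C C C (CoalgebraStruct.comul.rTensor C s)) := by
      intro s
      induction s with
      | zero => simp
      | add s t hs ht => simp only [tmul_add, map_add, hs, ht]
      | tmul x y =>
        simp only [TensorProduct.assoc_symm_tmul, LinearMap.rTensor_tmul, inducedCoact_tmul]
        induction (CoalgebraStruct.comul x : C ⊗[R] C) with
        | zero => simp
        | add s t hs ht => simp only [tmul_add, add_tmul, map_add, hs, ht]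
        | tmul z w => simp
    have h2 : ∀ s : C ⊗[R] C, CoalgebraStruct.comul.lTensor (M ⊗[R] C)
        ((TensorProduct.assoc R M C C).symm (m ⊗ₜ s)) =
        (TensorProduct.assoc R M C (C ⊗[R] C)).symm (m ⊗ₜ CoalgebraStruct.comul.lTensor C s) := by
      intro s
      induction s with
      | zero => simp
      | add s t hs ht => simp only [tmul_add, map_add, hs, ht]
      | tmul x y => simp
    rw [inducedCoact_tmul, h1, h2, Coalgebra.coassoc_apply]

theorem inducedCoact_counit (t : M ⊗[R] C) :
    TensorProduct.rid R (M ⊗[R] C)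
      (CoalgebraStruct.counit.lTensor (M ⊗[R] C) (inducedCoact R C M t)) = t := by
  induction t with
  | zero => simp
  | add s t hs ht => simp only [map_add, hs, ht]
  | tmul m c =>
    have h : ∀ s : C ⊗[R] C, TensorProduct.rid R (M ⊗[R] C)
        (CoalgebraStruct.counit.lTensor (M ⊗[R] C)
          ((TensorProduct.assoc R M C C).symm (m ⊗ₜ s))) =
        m ⊗ₜ TensorProduct.rid R C (CoalgebraStruct.counit.lTensor C s) := by
      intro s
      induction s with
      | zero => simp
      | add s t hs ht => simp only [tmul_add, map_add, hs, ht]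
      | tmul x y => simp
    rw [inducedCoact_tmul, h, Coalgebra.lTensor_counit_comul]
    simp

theorem inducedCoact_twist (t : M ⊗[R] C) (a : A) :
    (toInduced E M).toLinearMap.rTensor C (inducedCoact R C M (twist E M (t ⊗ₜ a))) =
      twist E (InducedCarrier E M)
        ((toInduced E M).toLinearMap.rTensor C (inducedCoact R C M t) ⊗ₜ a) := by
  induction t with
  | zero => simp
  | add s t hs ht => simp only [add_tmul, map_add, hs, ht]
  | tmul m c =>
    have h1 : ∀ s : A ⊗[R] C, inducedCoact R C M (actOn M m s) =
        (actOn M m).rTensor C ((TensorProduct.assoc R A C C).symm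
          (CoalgebraStruct.comul.lTensor A s)) := by
      intro s
      induction s with
      | zero => simp
      | add s t hs ht => simp only [map_add, hs, ht]
      | tmul x y =>
        simp only [actOn_tmul, inducedCoact_tmul, LinearMap.lTensor_tmul]
        induction (CoalgebraStruct.comul y : C ⊗[R] C) with
        | zero => simp
        | add s t hs ht => simp only [tmul_add, map_add, hs, ht]
        | tmul z w => simp
    have h2 : ∀ s : C ⊗[R] C, (toInduced E M).toLinearMap.rTensor C
        ((actOn M m).rTensor C (E.ψ.rTensor C
          ((TensorProduct.assoc R C A C).symm (E.ψ.lTensor C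
            (TensorProduct.assoc R C C A (s ⊗ₜ a)))))) =
        twist E (InducedCarrier E M) ((toInduced E M).toLinearMap.rTensor C
          ((TensorProduct.assoc R M C C).symm (m ⊗ₜ s)) ⊗ₜ[R] a) := by
      intro s
      induction s with
      | zero => simp
      | add s t hs ht => simp only [add_tmul, tmul_add, map_add, hs, ht]
      | tmul x y =>
        simp only [TensorProduct.assoc_tmul, TensorProduct.assoc_symm_tmul,
          LinearMap.lTensor_tmul, LinearMap.rTensor_tmul, twist_tmul_tmul]
        induction E.ψ (y ⊗ₜ a) with
        | zero => simp
        | add s t hs ht => simp only [tmul_add, map_add, hs, ht]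
        | tmul z w => simp [smul_toInduced, twist_tmul_tmul]
    rw [twist_tmul_tmul, h1, E.ψ_comul, LinearEquiv.symm_apply_apply, h2, inducedCoact_tmul]

/-- The entwined module `M ⊗ C` with `(m ⊗ c) a = ∑ m a_ψ ⊗ c^ψ` and coaction
`m ⊗ c ↦ ∑ (m ⊗ c₁) ⊗ c₂`. -/
def inducedModule : EntwinedModule E where
  carrier := InducedCarrier E M
  coact := (toInduced E M).toLinearMap.rTensor C ∘ₗ inducedCoact R C M ∘ₗ
    (toInduced E M).symm.toLinearMap
  coact_coassoc := by
    intro m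
    obtain ⟨t, rfl⟩ := (toInduced E M).surjective m
    have h1 : ∀ (s : (M ⊗[R] C) ⊗[R] C) (d : C), TensorProduct.assoc R (InducedCarrier E M) C C
        ((toInduced E M).toLinearMap.rTensor C s ⊗ₜ d) =
        (toInduced E M).toLinearMap.rTensor (C ⊗[R] C)
          (TensorProduct.assoc R (M ⊗[R] C) C C (s ⊗ₜ d)) := by
      intro s d
      induction s with
      | zero => simp
      | add s t hs ht => simp only [add_tmul, map_add, hs, ht]
      | tmul x y => simp
    have h2 : ∀ s : (M ⊗[R] C) ⊗[R] C, TensorProduct.assoc R (InducedCarrier E M) C C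
        (((toInduced E M).toLinearMap.rTensor C ∘ₗ inducedCoact R C M ∘ₗ
          (toInduced E M).symm.toLinearMap).rTensor C ((toInduced E M).toLinearMap.rTensor C s)) =
        (toInduced E M).toLinearMap.rTensor (C ⊗[R] C)
          (TensorProduct.assoc R (M ⊗[R] C) C C ((inducedCoact R C M).rTensor C s)) := by
      intro s
      induction s with
      | zero => simp
      | add s t hs ht => simp only [map_add, hs, ht]
      | tmul x y => simp [h1]
    have h3 : ∀ s : (M ⊗[R] C) ⊗[R] C, CoalgebraStruct.comul.lTensor (InducedCarrier E M)
        ((toInduced E M).toLinearMap.rTensor C s) =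
        (toInduced E M).toLinearMap.rTensor (C ⊗[R] C)
          (CoalgebraStruct.comul.lTensor (M ⊗[R] C) s) := by
      intro s
      induction s with
      | zero => simp
      | add s t hs ht => simp only [map_add, hs, ht]
      | tmul x y => simp
    have h4 : ((toInduced E M).toLinearMap.rTensor C ∘ₗ inducedCoact R C M ∘ₗ
        (toInduced E M).symm.toLinearMap) (toInduced E M t) =
        (toInduced E M).toLinearMap.rTensor C (inducedCoact R C M t) := rfl
    rw [h4, h2, h3, inducedCoact_coassoc]
  coact_counit := by
    intro m
    obtain ⟨t, rfl⟩ := (toInduced E M).surjective m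
    have h3 : ∀ s : (M ⊗[R] C) ⊗[R] C, TensorProduct.rid R (InducedCarrier E M)
        (CoalgebraStruct.counit.lTensor (InducedCarrier E M)
          ((toInduced E M).toLinearMap.rTensor C s)) =
        toInduced E M (TensorProduct.rid R (M ⊗[R] C)
          (CoalgebraStruct.counit.lTensor (M ⊗[R] C) s)) := by
      intro s
      induction s with
      | zero => simp
      | add s t hs ht => simp only [map_add, hs, ht]
      | tmul x y => simp
    simp only [LinearMap.comp_apply, LinearEquiv.coe_coe, LinearEquiv.symm_apply_apply]
    rw [h3, inducedCoact_counit]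
  coact_smul := by
    intro m a
    obtain ⟨t, rfl⟩ := (toInduced E M).surjective m
    have := inducedCoact_twist E M t a
    simpa [smul_toInduced] using this

theorem inducedModule_coact (t : M ⊗[R] C) : (inducedModule E M).coact (toInduced E M t) =
    (toInduced E M).toLinearMap.rTensor C (inducedCoact R C M t) := rfl

end Induced

/-! ### The ring `#_ψ^op(C, A)` -/

/-- `#_ψ^op(C, A)`: the `R`-module `Hom_R(C, A)` with the multiplication
`(f g)(c) = ∑ f(c₂)_ψ g(c₁^ψ)` and unit `η ∘ ε`. -/
def SmashOp (_E : EntwiningStructure R A C) : Type u := C →ₗ[R] A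

namespace SmashOp

instance : AddCommGroup (SmashOp E) := inferInstanceAs (AddCommGroup (C →ₗ[R] A))

instance : Module R (SmashOp E) := inferInstanceAs (Module R (C →ₗ[R] A))

variable {E}

/-- An element of `#_ψ^op(C, A)` as a linear map `C → A`. -/
def toLin (f : SmashOp E) : C →ₗ[R] A := f

variable (E)

/-- A linear map `C → A` as an element of `#_ψ^op(C, A)`. -/
def ofLin (f : C →ₗ[R] A) : SmashOp E := f

@[simp] theorem toLin_ofLin (f : C →ₗ[R] A) : (ofLin E f).toLin = f := rfl

instance : Mul (SmashOp E) where
  mul f g := (LinearMap.mul' R A ∘ₗ g.toLin.lTensor A ∘ₗ E.ψ ∘ₗ f.toLin.lTensor C ∘ₗ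
    CoalgebraStruct.comul : C →ₗ[R] A)

instance : One (SmashOp E) where
  one := (Algebra.linearMap R A ∘ₗ CoalgebraStruct.counit : C →ₗ[R] A)

variable {E}

theorem mul_apply (f g : SmashOp E) (c : C) : (f * g).toLin c =
    LinearMap.mul' R A (g.toLin.lTensor A (E.ψ (f.toLin.lTensor C (CoalgebraStruct.comul c)))) :=
  rfl

theorem one_toLin :
    (1 : SmashOp E).toLin = Algebra.linearMap R A ∘ₗ CoalgebraStruct.counit := rfl

theorem actBy_one (M : EntwinedModule E) (m : M) : M.actBy (1 : SmashOp E).toLin m = m := by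
  refine Eq.trans ?_ (M.coact_counit m)
  simp only [EntwinedModule.actBy, one_toLin, LinearMap.comp_apply]
  induction M.coact m with
  | zero => simp
  | add s t hs ht => simp only [map_add, hs, ht]
  | tmul x y =>
    simp [Algebra.algebraMap_eq_smul_one]

theorem actBy_mul (M : EntwinedModule E) (f g : SmashOp E) (m : M) :
    M.actBy (f * g).toLin m = M.actBy g.toLin (M.actBy f.toLin m) := by
  let Φ : M ⊗[R] (C ⊗[R] C) →ₗ[R] M := rightAct R A M ∘ₗ
    (LinearMap.mul' R A ∘ₗ g.toLin.lTensor A ∘ₗ E.ψ ∘ₗ f.toLin.lTensor C).lTensor M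
  have h1 : ∀ s : M ⊗[R] C, rightAct R A M ((f * g).toLin.lTensor M s) =
      Φ (CoalgebraStruct.comul.lTensor M s) := by
    intro s
    induction s with
    | zero => simp
    | add s t hs ht => simp only [map_add, hs, ht]
    | tmul x y => simp [Φ, mul_apply]
  have h3 : ∀ (s : M ⊗[R] C) (d : C), Φ (TensorProduct.assoc R M C C (s ⊗ₜ d)) =
      rightAct R A M (g.toLin.lTensor M (twist E M (s ⊗ₜ f.toLin d))) := by
    intro s d
    induction s with
    | zero => simp
    | add s t hs ht => simp only [add_tmul, map_add, hs, ht]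
    | tmul x y =>
      simp only [TensorProduct.assoc_tmul, twist_tmul_tmul, Φ, LinearMap.comp_apply,
        LinearMap.lTensor_tmul]
      induction E.ψ (y ⊗ₜ f.toLin d) with
      | zero => simp
      | add s t hs ht => simp only [tmul_add, map_add, hs, ht]
      | tmul z w => simp [mul_smul]
  have h2 : ∀ s : M ⊗[R] C, Φ (TensorProduct.assoc R M C C (M.coact.rTensor C s)) =
      M.actBy g.toLin (rightAct R A M (f.toLin.lTensor M s)) := by
    intro s
    induction s with
    | zero => simp
    | add s t hs ht => simp only [map_add, hs, ht]
    | tmul x y =>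
      simp only [LinearMap.rTensor_tmul, LinearMap.lTensor_tmul, h3, rightAct_tmul]
      simp [EntwinedModule.actBy, M.coact_smul]
  simp only [EntwinedModule.actBy, LinearMap.comp_apply] at h2 ⊢
  rw [h1, ← M.coact_coassoc, h2]

theorem actBy_induced (f : C →ₗ[R] A) (c : C) :
    (inducedModule E A).actBy f (toInduced E A (1 ⊗ₜ c)) =
      toInduced E A (E.ψ (f.lTensor C (CoalgebraStruct.comul c))) := by
  have h0 : ∀ s : C ⊗[R] C, rightAct R A (InducedCarrier E A)
      (f.lTensor (InducedCarrier E A) ((toInduced E A).toLinearMap.rTensor C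
        ((TensorProduct.assoc R A C C).symm (1 ⊗ₜ s)))) =
      toInduced E A (E.ψ (f.lTensor C s)) := by
    intro s
    induction s with
    | zero => simp
    | add s t hs ht => simp only [tmul_add, map_add, hs, ht]
    | tmul x y =>
      simp only [TensorProduct.assoc_symm_tmul, LinearMap.rTensor_tmul, LinearMap.lTensor_tmul,
        LinearEquiv.coe_coe, rightAct_tmul, smul_toInduced, twist_tmul_tmul]
      congr 1
      induction E.ψ (x ⊗ₜ f y) with
      | zero => simp
      | add s t hs ht => simp only [map_add, hs, ht]
      | tmul z w => simp
  refine Eq.trans ?_ (h0 _)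
  rw [← inducedCoact_tmul, ← inducedModule_coact]
  rfl

theorem ext_actBy {f g : SmashOp E}
    (h : ∀ t, (inducedModule E A).actBy f.toLin t = (inducedModule E A).actBy g.toLin t) :
    f = g := by
  have key : ∀ (f : SmashOp E) (c : C), f.toLin c = TensorProduct.rid R A
      (CoalgebraStruct.counit.lTensor A (E.ψ (f.toLin.lTensor C (CoalgebraStruct.comul c)))) := by
    intro f c
    have h2 : ∀ s : C ⊗[R] C, TensorProduct.rid R A (CoalgebraStruct.counit.lTensor A
        (E.ψ (f.toLin.lTensor C s))) =
        f.toLin (TensorProduct.lid R C (CoalgebraStruct.counit.rTensor C s)) := by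
      intro s
      induction s with
      | zero => simp
      | add s t hs ht => simp only [map_add, hs, ht]
      | tmul x y => simp [E.ψ_counit]
    rw [h2, Coalgebra.rTensor_counit_comul]
    simp
  refine LinearMap.ext fun c => ?_
  refine (key f c).trans (Eq.trans ?_ (key g c).symm)
  have := h (toInduced E A (1 ⊗ₜ c))
  rw [actBy_induced, actBy_induced] at this
  rw [(toInduced E A).injective this]

theorem toLin_add (f g : SmashOp E) : (f + g).toLin = f.toLin + g.toLin := rfl

theorem toLin_smul (r : R) (f : SmashOp E) : (r • f).toLin = r • f.toLin := rfl

theorem toLin_zero : (0 : SmashOp E).toLin = 0 := rfl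

theorem toLin_ext {f g : SmashOp E} (h : ∀ c, f.toLin c = g.toLin c) : f = g := LinearMap.ext h

variable (E)

instance : Ring (SmashOp E) :=
  { (inferInstance : AddCommGroup (SmashOp E)), (inferInstance : Mul (SmashOp E)),
    (inferInstance : One (SmashOp E)) with
    left_distrib := fun f g h => toLin_ext fun c => by
      simp [toLin_add, mul_apply, LinearMap.lTensor_add]
    right_distrib := fun f g h => toLin_ext fun c => by
      simp [toLin_add, mul_apply, LinearMap.lTensor_add]
    zero_mul := fun f => toLin_ext fun c => by simp [toLin_zero, mul_apply]
    mul_zero := fun f => toLin_ext fun c => by simp [toLin_zero, mul_apply]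
    mul_assoc := fun f g h => ext_actBy fun t => by simp only [actBy_mul]
    one_mul := fun f => ext_actBy fun t => by rw [actBy_mul, actBy_one]
    mul_one := fun f => ext_actBy fun t => by rw [actBy_mul, actBy_one] }

instance : Algebra R (SmashOp E) :=
  Algebra.ofModule
    (fun r f g => toLin_ext fun c => by simp [toLin_smul, mul_apply, LinearMap.lTensor_smul])
    (fun r f g => toLin_ext fun c => by simp [toLin_smul, mul_apply, LinearMap.lTensor_smul])

/-- The ring homomorphism `A → #_ψ^op(C, A)`, `a ↦ ε(-) a`, that makes `#_ψ^op(C, A)` an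
`A`-ring. -/
def ofAlg : A →+* SmashOp E where
  toFun a := ofLin E ((CoalgebraStruct.counit : C →ₗ[R] R).smulRight a)
  map_one' := toLin_ext fun c => by
    simp [one_toLin, Algebra.algebraMap_eq_smul_one]
  map_zero' := toLin_ext fun c => by simp [toLin_zero]
  map_add' a b := toLin_ext fun c => by simp [toLin_add]
  map_mul' a b := toLin_ext fun c => by
    have h1 : ∀ s : C ⊗[R] C,
        ((CoalgebraStruct.counit : C →ₗ[R] R).smulRight a).lTensor C s =
          TensorProduct.rid R C (CoalgebraStruct.counit.lTensor C s) ⊗ₜ a := by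
      intro s
      induction s with
      | zero => simp
      | add s t hs ht => simp only [add_tmul, map_add, hs, ht]
      | tmul x y => simp [smul_tmul]
    have h2 : ∀ t : A ⊗[R] C, LinearMap.mul' R A
        (((CoalgebraStruct.counit : C →ₗ[R] R).smulRight b).lTensor A t) =
          TensorProduct.rid R A (CoalgebraStruct.counit.lTensor A t) * b := by
      intro t
      induction t with
      | zero => simp
      | add s t hs ht => simp only [add_mul, map_add, hs, ht]
      | tmul x y => simp
    rw [mul_apply, toLin_ofLin, toLin_ofLin, toLin_ofLin, h1, Coalgebra.lTensor_counit_comul, h2,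
      TensorProduct.rid_tmul, one_smul, E.ψ_counit]
    simp

end SmashOp

/-- Every entwined module is a right `#_ψ^op(C, A)`-module through `m f = ∑ m₀ f(m₁)`. -/
instance smashModule (M : EntwinedModule E) : Module (SmashOp E)ᵐᵒᵖ M where
  smul f m := M.actBy f.unop.toLin m
  one_smul m := SmashOp.actBy_one M m
  mul_smul f g m := SmashOp.actBy_mul M g.unop f.unop m
  smul_zero f := map_zero _
  smul_add f m n := map_add _ m n
  add_smul f g m := by
    change M.actBy (f.unop.toLin + g.unop.toLin) m = M.actBy f.unop.toLin m + M.actBy g.unop.toLin m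
    simp [EntwinedModule.actBy, LinearMap.lTensor_add]
  zero_smul m := by
    change M.actBy 0 m = 0
    simp [EntwinedModule.actBy]

/-- The functor `M_A^C(ψ) → M_{#_ψ^op(C, A)}`, the identity on underlying sets, with
`m f = ∑ m₀ f(m₁)`. -/
def toSmashModules : EntwinedModule E ⥤ ModuleCat.{u} (SmashOp E)ᵐᵒᵖ where
  obj M := ModuleCat.of (SmashOp E)ᵐᵒᵖ M
  map {M N} h := ModuleCat.ofHom
    { toFun := h.toLinearMap
      map_add' := map_add _
      map_smul' := fun f m => by
        have h1 : ∀ s : M ⊗[R] C, h.toLinearMap (rightAct R A M (f.unop.toLin.lTensor M s)) =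
            rightAct R A N (f.unop.toLin.lTensor N (h.toLinearMap.rTensor C s)) := by
          intro s
          induction s with
          | zero => simp
          | add s t hs ht => simp only [map_add, hs, ht]
          | tmul x y => simp [h.map_smul]
        change h.toLinearMap (rightAct R A M (f.unop.toLin.lTensor M (M.coact m))) =
          rightAct R A N (f.unop.toLin.lTensor N (N.coact (h.toLinearMap m)))
        rw [h1, h.map_coact] }

/-! ### The `α`-condition and `#`-rational modules -/

/-- `α_M^ψ : M ⊗ C → Hom_R(#_ψ^op(C, A), M)`, `m ⊗ c ↦ [f ↦ m f(c)]`. -/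
def alphaMap (M : Type u) [AddCommGroup M] [Module R M] [Module Aᵐᵒᵖ M]
    [IsScalarTower R Aᵐᵒᵖ M] : M ⊗[R] C →ₗ[R] SmashOp E →ₗ[R] M :=
  LinearMap.mk₂ R (fun t f => rightAct R A M (f.toLin.lTensor M t))
    (fun s t f => by simp) (fun r t f => by simp)
    (fun t f g => by simp [SmashOp.toLin_add, LinearMap.lTensor_add])
    (fun r t f => by simp [SmashOp.toLin_smul, LinearMap.lTensor_smul])

@[simp] theorem alphaMap_tmul (M : Type u) [AddCommGroup M] [Module R M] [Module Aᵐᵒᵖ M]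
    [IsScalarTower R Aᵐᵒᵖ M] (m : M) (c : C) (f : SmashOp E) :
    alphaMap E M (m ⊗ₜ c) f = op (f.toLin c) • m := by
  simp [alphaMap]

/-- `(A, C, ψ)` satisfies the `α`-condition: `α_M^ψ` is injective for every right
`A`-module `M`. -/
def EntwiningStructure.AlphaCondition : Prop :=
  ∀ (M : Type u) [AddCommGroup M] [Module R M] [Module Aᵐᵒᵖ M] [IsScalarTower R Aᵐᵒᵖ M],
    Function.Injective (alphaMap E M)

section Rational

variable (M : Type u) [AddCommGroup M] [Module (SmashOp E)ᵐᵒᵖ M]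

/-- The `R`-module underlying a right `#_ψ^op(C, A)`-module. -/
abbrev restrictBase : Module R M := Module.compHom M (algebraMap R (SmashOp E)ᵐᵒᵖ)

/-- The right `A`-module underlying a right `#_ψ^op(C, A)`-module, along `A → #_ψ^op(C, A)`. -/
abbrev restrictAlg : Module Aᵐᵒᵖ M := Module.compHom M (SmashOp.ofAlg E).op

theorem restrict_isScalarTower :
    letI := restrictBase E M
    letI := restrictAlg E M
    IsScalarTower R Aᵐᵒᵖ M := by
  let _ := restrictBase E M
  let _ := restrictAlg E M
  refine ⟨fun r a m => ?_⟩
  change op (SmashOp.ofAlg E (r • a.unop)) • m =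
    algebraMap R (SmashOp E)ᵐᵒᵖ r • op (SmashOp.ofAlg E a.unop) • m
  have : SmashOp.ofAlg E (r • a.unop) = r • SmashOp.ofAlg E a.unop :=
    SmashOp.toLin_ext fun c => by
      change (CoalgebraStruct.counit c : R) • r • a.unop = r • (CoalgebraStruct.counit c : R) • a.unop
      rw [smul_comm]
  rw [this, MulOpposite.op_smul, algebra_compatible_smul (SmashOp E)ᵐᵒᵖ, smul_eq_mul, mul_smul]

/-- `Rat^C(M) = ρ_M⁻¹(M ⊗ C)`: the elements `m` for which `f ↦ m f` is in the image of
`α_M^ψ`. -/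
def ratPart : Set M :=
  letI := restrictBase E M
  letI := restrictAlg E M
  haveI := restrict_isScalarTower E M
  {m | ∃ t : M ⊗[R] C, ∀ f : SmashOp E, alphaMap E M t f = op f • m}

end Rational

/-- `#`-rational right `#_ψ^op(C, A)`-modules. -/
def IsRational : ObjectProperty (ModuleCat.{u} (SmashOp E)ᵐᵒᵖ) :=
  fun M => ratPart E M = Set.univ

end Entwining

/-! ### Subgenerated modules and isomorphisms of categories -/

section Categories

open CategoryTheory

/-- `G` is `K`-generated: a quotient of a direct sum of copies of `K`. -/
def IsGeneratedBy {S : Type u} [Ring S] (K G : ModuleCat.{u} S) : Prop :=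
  ∃ (ι : Type u) (p : (ι →₀ K) →ₗ[S] G), Function.Surjective p

/-- The objects of `σ[K]`: modules isomorphic to a submodule of a `K`-generated module. -/
def IsSubgeneratedBy {S : Type u} [Ring S] (K : ModuleCat.{u} S) :
    ObjectProperty (ModuleCat.{u} S) :=
  fun N => ∃ G : ModuleCat.{u} S, IsGeneratedBy K G ∧ ∃ i : N →ₗ[S] G, Function.Injective i

/-- A functor is an isomorphism of categories if it has a strict two-sided inverse. -/
def IsIsoOfCategories {𝒞 𝒟 : Type*} [Category 𝒞] [Category 𝒟] (F : 𝒞 ⥤ 𝒟) : Prop :=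
  ∃ G : 𝒟 ⥤ 𝒞, F ⋙ G = 𝟭 𝒞 ∧ G ⋙ F = 𝟭 𝒟

end Categories

/-! ### The dual entwining map -/

section Dual

set_option linter.unusedSectionVars false

variable {R A C : Type u} [CommRing R] [IsNoetherianRing R] [Ring A] [Algebra R A]
  [IsAlphaAlgebra R A] [AddCommGroup C] [Module R C] [Coalgebra R C]

/-- The underlying type of a subalgebra `A'` of the convolution algebra `C^*`. -/
def DualAlg (A' : Subalgebra R (WithConv (C →ₗ[R] R))) : Type u := A'

instance (A' : Subalgebra R (WithConv (C →ₗ[R] R))) : Ring (DualAlg A') :=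
  inferInstanceAs (Ring A')

instance (A' : Subalgebra R (WithConv (C →ₗ[R] R))) : Algebra R (DualAlg A') :=
  inferInstanceAs (Algebra R A')

/-- The inclusion `A' → C^*`. -/
def dualAlgIncl (A' : Subalgebra R (WithConv (C →ₗ[R] R))) : DualAlg A' →ₗ[R] Module.Dual R C where
  toFun g := g.1.ofConv
  map_add' _ _ := rfl
  map_smul' _ _ := rfl

theorem dualAlgIncl_injective (A' : Subalgebra R (WithConv (C →ₗ[R] R))) :
    Function.Injective (dualAlgIncl A') :=
  fun _ _ h => Subtype.ext (WithConv.ofConv_injective h)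

/-- The inclusion `C' → A^*` of a subcoalgebra of `A°`. -/
def dualCoalgIncl (C' : Subcoalgebra R (FiniteDual R A)) : C' →ₗ[R] Module.Dual R A :=
  FiniteDual.incl R A ∘ₗ C'.incl

theorem dualCoalgIncl_isPureMap (C' : Subcoalgebra R (FiniteDual R A)) :
    IsPureMap (LinearMap.ltoFun R A R R ∘ₗ dualCoalgIncl C') := by
  intro N _ _
  have h : LinearMap.ltoFun R A R R ∘ₗ dualCoalgIncl C' =
      (LinearMap.ltoFun R A R R ∘ₗ FiniteDual.incl R A) ∘ₗ C'.incl := rfl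
  rw [h, LinearMap.rTensor_comp, LinearMap.coe_comp]
  exact (finiteDual_isPureMap R A N).comp (C'.rTensor_incl_injective N)

/-- `C' ⊗ A' → (A ⊗ C)^*`, `f ⊗ g ↦ [a ⊗ c ↦ f(a) g(c)]`. -/
def pairCA (A' : Subalgebra R (WithConv (C →ₗ[R] R))) (C' : Subcoalgebra R (FiniteDual R A)) :
    C' ⊗[R] DualAlg A' →ₗ[R] Module.Dual R (A ⊗[R] C) :=
  pairTensor (dualCoalgIncl C') (dualAlgIncl A')

/-- `A' ⊗ C' → (C ⊗ A)^*`, `g ⊗ f ↦ [c ⊗ a ↦ g(c) f(a)]`. -/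
def pairAC (A' : Subalgebra R (WithConv (C →ₗ[R] R))) (C' : Subcoalgebra R (FiniteDual R A)) :
    DualAlg A' ⊗[R] C' →ₗ[R] Module.Dual R (C ⊗[R] A) :=
  pairTensor (dualAlgIncl A') (dualCoalgIncl C')

theorem pairAC_injective (A' : Subalgebra R (WithConv (C →ₗ[R] R)))
    (C' : Subcoalgebra R (FiniteDual R A)) : Function.Injective (pairAC A' C') :=
  pairTensor_injective _ _ (dualAlgIncl_injective A') (dualCoalgIncl_isPureMap C')

variable (E : EntwiningStructure R A C) (A' : Subalgebra R (WithConv (C →ₗ[R] R)))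
  (C' : Subcoalgebra R (FiniteDual R A))

/-- `ψ^*(C' ⊗ A') ⊆ A' ⊗ C'` inside `(C ⊗ A)^*`. -/
def DualStable : Prop :=
  (LinearMap.range (pairCA A' C')).map E.ψ.dualMap ≤ LinearMap.range (pairAC A' C')

/-- The map `φ : C' ⊗ A' → A' ⊗ C'` induced by `ψ^*`: the unique linear map with
`φ(f ⊗ g)(c ⊗ a) = ∑ f(a_ψ) g(c^ψ)`. -/
def dualEntwiningMap (h : DualStable E A' C') : C' ⊗[R] DualAlg A' →ₗ[R] DualAlg A' ⊗[R] C' :=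
  factorThrough (pairAC A' C') (pairAC_injective A' C') (E.ψ.dualMap ∘ₗ pairCA A' C')
    (fun x => h ⟨_, ⟨x, rfl⟩, rfl⟩)

theorem pairAC_dualEntwiningMap (h : DualStable E A' C') (t : C' ⊗[R] DualAlg A') :
    pairAC A' C' (dualEntwiningMap E A' C' h t) = pairCA A' C' t ∘ₗ E.ψ :=
  factorThrough_spec _ (pairAC_injective A' C') _ _ t

end Dual

end

end DualEntwining

open DualEntwining CategoryTheory TensorProduct

namespace DualEntwining

noncomputable section

open MulOpposite

/-! The argument has two independent halves, joined by one property of the coalgebra: for every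
`R`-module `X`, the elements of `X ⊗ C` are separated by the functionals on `C` (`SeparatedByDual`).
For a subcoalgebra of `A°` this holds because it is pure in `R^A`, and over a noetherian ring the
coordinates separate the elements of `X ⊗ R^A`; evaluations at elements of `A` already suffice.

The module-theoretic half holds for any entwining structure whose coalgebra has this property. A
functional `g` on `C` gives the ring element `g(-)1`, and the value of `α_M` there is evaluation of
the second tensor factor at `g`. Hence `α_M` is injective, and in a rational module the tensor
representing `f ↦ mf` is unique. These tensors form the coaction, and its axioms become identities
between products in the ring, tested by functionals. The `R`-action, `A`-action and coaction are all
read off from the action of the ring, so the functor is bijective on objects onto the rational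
modules, and it is fully faithful. If `C` is finitely generated projective, a dual basis represents
every `f ↦ mf`, so all modules are rational.

For `σ[A ⊗ C]`, rationality passes to direct sums, quotients and submodules. Conversely the coaction
embeds an entwined module `M` in `M ⊗ C`, which is a quotient of a direct sum of copies of `A ⊗ C`.

The other half shows that `φ` is an entwining map. With respect to the pairings, `φ` is adjoint to
`ψ`, the product of `A'` to `Δ_C`, and `Δ_{C'}` to the product of `A`. Each axiom for `φ` is thus
the transpose of an axiom for `ψ`, with algebra and coalgebra axioms exchanged, and injectivity of
the pairings allows it to be checked there. -/

/-- A fully faithful functor that is bijective on objects is an isomorphism of categories. -/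
theorem isIsoOfCategories_of_bijective {𝒞 𝒟 : Type*} [Category 𝒞] [Category 𝒟] (F : 𝒞 ⥤ 𝒟)
    [F.Full] [F.Faithful] (hF : Function.Bijective F.obj) : IsIsoOfCategories F := by
  obtain ⟨g, hgl, hgr⟩ := Function.bijective_iff_has_inverse.1 hF
  let G : 𝒟 ⥤ 𝒞 :=
    { obj := g
      -- `F.obj (g X) = X` is only a propositional equality, so a morphism is transported along it
      -- before it is lifted.
      map := fun {X Y} f => F.preimage (eqToHom (hgr X) ≫ f ≫ eqToHom (hgr Y).symm)
      map_id := fun X => F.map_injective (by simp)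
      map_comp := fun f h => F.map_injective (by simp) }
  refine ⟨G, CategoryTheory.Functor.ext hgl fun X Y f => F.map_injective ?_,
    CategoryTheory.Functor.ext hgr fun X Y f => ?_⟩
  · simp [G, eqToHom_map]
  · simp [G]

/-! ### Separation of tensors by functionals. -/

/-- The elements of `X ⊗ C` are separated by the functionals on `C`, for every `X`. -/
def SeparatedByDual (R C : Type u) [CommRing R] [AddCommGroup C] [Module R C] : Prop :=
  ∀ (X : Type u) [AddCommGroup X] [Module R X] (t : X ⊗[R] C),
    (∀ g : Module.Dual R C, evalRight X g t = 0) → t = 0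

theorem SeparatedByDual.ext {R C X : Type u} [CommRing R] [AddCommGroup C] [Module R C]
    [AddCommGroup X] [Module R X] (hC : SeparatedByDual R C) {s t : X ⊗[R] C}
    (h : ∀ g : Module.Dual R C, evalRight X g s = evalRight X g t) : s = t :=
  sub_eq_zero.1 (hC X _ fun g => by rw [map_sub, h, sub_self])

theorem evalRight_rTensor {R X Y C : Type u} [CommRing R] [AddCommGroup C] [Module R C]
    [AddCommGroup X] [Module R X] [AddCommGroup Y] [Module R Y] (h : X →ₗ[R] Y)
    (g : Module.Dual R C) (t : X ⊗[R] C) :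
    evalRight Y g (h.rTensor C t) = h (evalRight X g t) := by
  induction t with
  | zero => simp
  | tmul x y => simp
  | add s t hs ht => simp only [map_add, hs, ht]

/-- The elements of the range of `h ⊗ C` can be tested by functionals on `C`. -/
theorem SeparatedByDual.mem_range_rTensor {R C X Y : Type u} [CommRing R] [AddCommGroup C]
    [Module R C] [AddCommGroup X] [Module R X] [AddCommGroup Y] [Module R Y]
    (hC : SeparatedByDual R C) (h : X →ₗ[R] Y) {t : Y ⊗[R] C}
    (ht : ∀ g : Module.Dual R C, evalRight Y g t ∈ LinearMap.range h) :
    t ∈ LinearMap.range (h.rTensor C) := by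
  -- By right exactness the range is the kernel of the map to `(Y / h(X)) ⊗ C`, so separation is
  -- applied to the quotient module; this is why it is required for every `X`.
  refine (rTensor_exact C (LinearMap.exact_map_mkQ_range h) (Submodule.mkQ_surjective _) t).1 ?_
  refine hC _ _ fun g => ?_
  rw [evalRight_rTensor]
  exact (Submodule.Quotient.mk_eq_zero _).2 (ht g)

section Entwining

variable {R A C : Type u} [CommRing R] [Ring A] [Algebra R A] [AddCommGroup C] [Module R C]
  [Coalgebra R C] (E : EntwiningStructure R A C)

/-! ### Products in `#_ψ^op(C, A)` of elements coming from `C^*` and from `A`. -/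

namespace SmashOp

/-- The element `c ↦ g(c) 1` of `#_ψ^op(C, A)`. -/
def ofDual (g : Module.Dual R C) : SmashOp E := ofLin E (g.smulRight 1)

@[simp] theorem ofDual_toLin (g : Module.Dual R C) (c : C) :
    (ofDual E g).toLin c = g c • (1 : A) := rfl

@[simp] theorem ofAlg_toLin (a : A) (c : C) :
    (ofAlg E a).toLin c = (CoalgebraStruct.counit c : R) • a := rfl

variable {E}

/-- Since `ψ` fixes `1`, no entwining remains and the product is `c ↦ g(c₂) g'(c₁)`: the convolution
product in opposite order. It encodes coassociativity of the coaction. -/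
theorem ofDual_mul_ofDual (g g' : Module.Dual R C) :
    ofDual E g * ofDual E g' = ofDual E (g' ∘ₗ evalRight C g ∘ₗ CoalgebraStruct.comul) := by
  refine toLin_ext fun c => ?_
  rw [mul_apply, ofDual_toLin, LinearMap.comp_apply, LinearMap.comp_apply]
  induction (CoalgebraStruct.comul c : C ⊗[R] C) with
  | zero => simp
  | add s t hs ht => simp only [map_add, add_smul, hs, ht]
  | tmul x y => simp [E.ψ_one, mul_smul]

theorem ofAlg_mul_apply (a : A) (f : SmashOp E) (c : C) :
    (ofAlg E a * f).toLin c = LinearMap.mul' R A (f.toLin.lTensor A (E.ψ (c ⊗ₜ a))) := by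
  have h1 : ∀ s : C ⊗[R] C, (ofAlg E a).toLin.lTensor C s =
      TensorProduct.rid R C (CoalgebraStruct.counit.lTensor C s) ⊗ₜ a := by
    intro s
    induction s with
    | zero => simp
    | add s t hs ht => simp only [add_tmul, map_add, hs, ht]
    | tmul x y => simp [smul_tmul]
  rw [mul_apply, h1, Coalgebra.lTensor_counit_comul]
  simp

/-- These products remember `ψ` up to functionals on `C`, which is what the compatibility of
coaction and `A`-action needs. -/
theorem ofAlg_mul_ofDual_apply (a : A) (g : Module.Dual R C) (c : C) :
    (ofAlg E a * ofDual E g).toLin c = evalRight A g (E.ψ (c ⊗ₜ a)) := by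
  rw [ofAlg_mul_apply]
  induction E.ψ (c ⊗ₜ a) with
  | zero => simp
  | add s t hs ht => simp only [map_add, hs, ht]
  | tmul x y => simp

/-- In this order the product is a rank-one map `C → A`; a dual basis of `C` writes every `f` as a
sum of such maps. -/
theorem ofDual_mul_ofAlg_apply (g : Module.Dual R C) (a : A) (c : C) :
    (ofDual E g * ofAlg E a).toLin c = g c • a := by
  have h1 : ∀ s : C ⊗[R] C, LinearMap.mul' R A ((ofAlg E a).toLin.lTensor A
      (E.ψ ((ofDual E g).toLin.lTensor C s))) =
      g (TensorProduct.lid R C (CoalgebraStruct.counit.rTensor C s)) • a := by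
    intro s
    induction s with
    | zero => simp
    | add s t hs ht => simp only [map_add, add_smul, hs, ht]
    | tmul x y => simp [E.ψ_one, smul_smul, mul_comm]
  rw [mul_apply, h1, Coalgebra.rTensor_counit_comul]
  simp

end SmashOp

open SmashOp

/-! ### Values of `α_M` at special elements. -/

section AlphaMap

variable {M : Type u} [AddCommGroup M] [Module R M] [Module Aᵐᵒᵖ M] [IsScalarTower R Aᵐᵒᵖ M]

/-- The link between `α_M` and separation: testing a tensor by functionals on `C` is testing it by
particular ring elements. -/
theorem alphaMap_ofDual (g : Module.Dual R C) (t : M ⊗[R] C) :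
    alphaMap E M t (ofDual E g) = evalRight M g t := by
  induction t with
  | zero => simp
  | add s t hs ht => simp only [map_add, LinearMap.add_apply, hs, ht]
  | tmul x y => simp

theorem alphaMap_one (t : M ⊗[R] C) :
    alphaMap E M t 1 = TensorProduct.rid R M (CoalgebraStruct.counit.lTensor M t) := by
  induction t with
  | zero => simp
  | add s t hs ht => simp only [map_add, LinearMap.add_apply, hs, ht]
  | tmul x y => simp [one_toLin, Algebra.algebraMap_eq_smul_one]

theorem alphaMap_rTensor {N : Type u} [AddCommGroup N] [Module R N] [Module Aᵐᵒᵖ N]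
    [IsScalarTower R Aᵐᵒᵖ N] (p : M →ₗ[R] N) (hp : ∀ (a : A) m, p (op a • m) = op a • p m)
    (t : M ⊗[R] C) (f : SmashOp E) :
    alphaMap E N (p.rTensor C t) f = p (alphaMap E M t f) := by
  induction t with
  | zero => simp
  | add s t hs ht => simp only [map_add, LinearMap.add_apply, hs, ht]
  | tmul x y => simp [hp]

end AlphaMap

/-! ### Tensors that represent the action on an element. -/

section Compatible

/-- The `R`- and `A`-module structures of `M` are those induced by its right
`#_ψ^op(C, A)`-module structure. -/
structure SmashCompatible (M : Type u) [AddCommGroup M] [Module R M] [Module Aᵐᵒᵖ M]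
    [Module (SmashOp E)ᵐᵒᵖ M] : Prop where
  base_smul : ∀ (r : R) (m : M), r • m = algebraMap R (SmashOp E)ᵐᵒᵖ r • m
  alg_smul : ∀ (a : A) (m : M), op a • m = op (ofAlg E a) • m

theorem smashCompatible_restrict (M : Type u) [AddCommGroup M] [Module (SmashOp E)ᵐᵒᵖ M] :
    letI := restrictBase E M
    letI := restrictAlg E M
    SmashCompatible E M :=
  letI := restrictBase E M
  letI := restrictAlg E M
  ⟨fun _ _ => rfl, fun _ _ => rfl⟩

variable {M : Type u} [AddCommGroup M] [Module R M] [Module Aᵐᵒᵖ M]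
    [Module (SmashOp E)ᵐᵒᵖ M]

variable {E}

/-- With `SmashCompatible.alg_eq`, this lets arbitrary compatible instances be replaced by the
restricted ones built into `ratPart`. -/
theorem SmashCompatible.base_eq (hM : SmashCompatible E M) :
    ‹Module R M› = restrictBase E M := Module.ext' _ _ hM.base_smul

theorem SmashCompatible.alg_eq (hM : SmashCompatible E M) :
    ‹Module Aᵐᵒᵖ M› = restrictAlg E M := Module.ext' _ _ fun a => hM.alg_smul a.unop

variable {N : Type u} [AddCommGroup N] [Module R N] [Module Aᵐᵒᵖ N]
  [Module (SmashOp E)ᵐᵒᵖ N]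

theorem SmashCompatible.map_base_smul (hM : SmashCompatible E M) (hN : SmashCompatible E N)
    (p : M →ₗ[(SmashOp E)ᵐᵒᵖ] N) (r : R) (m : M) : p (r • m) = r • p m := by
  rw [hM.base_smul, hN.base_smul, map_smul]

theorem SmashCompatible.map_alg_smul (hM : SmashCompatible E M) (hN : SmashCompatible E N)
    (p : M →ₗ[(SmashOp E)ᵐᵒᵖ] N) (a : A) (m : M) : p (op a • m) = op a • p m := by
  rw [hM.alg_smul, hN.alg_smul, map_smul]

/-- A `#_ψ^op(C, A)`-linear map as an `R`-linear map. -/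
def SmashCompatible.linearMap (hM : SmashCompatible E M) (hN : SmashCompatible E N)
    (p : M →ₗ[(SmashOp E)ᵐᵒᵖ] N) : M →ₗ[R] N where
  toFun := p
  map_add' := map_add p
  map_smul' := hM.map_base_smul hN p

variable [IsScalarTower R Aᵐᵒᵖ M]

variable (E) in
/-- `t` represents `f ↦ m f`. -/
def Represents (t : M ⊗[R] C) (m : M) : Prop := ∀ f : SmashOp E, alphaMap E M t f = op f • m

theorem SmashCompatible.mem_ratPart (hM : SmashCompatible E M) (m : M) :
    m ∈ ratPart E M ↔ ∃ t : M ⊗[R] C, Represents E t m := by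
  have h1 := hM.base_eq
  have h2 := hM.alg_eq
  subst h1
  subst h2
  rfl

theorem Represents.add {s t : M ⊗[R] C} {m n : M} (hs : Represents E s m)
    (ht : Represents E t n) : Represents E (s + t) (m + n) := fun f => by
  rw [map_add, LinearMap.add_apply, hs, ht, smul_add]

theorem represents_zero : Represents E (0 : M ⊗[R] C) 0 := fun f => by simp

theorem SmashCompatible.represents_smul (hM : SmashCompatible E M) {t : M ⊗[R] C} {m : M}
    (ht : Represents E t m) (r : R) : Represents E (r • t) (r • m) := fun f => by
  rw [map_smul, LinearMap.smul_apply, ht, hM.base_smul, hM.base_smul, ← mul_smul, ← mul_smul,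
    Algebra.commutes]

theorem Represents.evalRight {t : M ⊗[R] C} {m : M} (ht : Represents E t m)
    (g : Module.Dual R C) : evalRight M g t = op (ofDual E g) • m := by
  rw [← alphaMap_ofDual E, ht]

/-- Uniqueness makes any choice of representing tensors additive and `R`-linear, and makes linear
maps over the ring colinear. -/
theorem Represents.unique (hC : SeparatedByDual R C) {s t : M ⊗[R] C} {m : M}
    (hs : Represents E s m) (ht : Represents E t m) : s = t :=
  hC.ext fun g => by rw [hs.evalRight, ht.evalRight]

variable [IsScalarTower R Aᵐᵒᵖ N]

theorem Represents.map (hM : SmashCompatible E M) (hN : SmashCompatible E N)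
    (p : M →ₗ[(SmashOp E)ᵐᵒᵖ] N) {t : M ⊗[R] C} {m : M} (ht : Represents E t m) :
    Represents E ((hM.linearMap hN p).rTensor C t) (p m) := fun f => by
  rw [alphaMap_rTensor E _ (hM.map_alg_smul hN p), ht, ← map_smul]
  rfl

/-- Rationality descends to submodules: evaluating `t` at a functional `g` gives `p (m · ofDual g)`,
which lies in the image of `p`, so `t` itself comes from `M ⊗ C`. -/
theorem Represents.of_map (hC : SeparatedByDual R C) (hM : SmashCompatible E M)
    (hN : SmashCompatible E N) (p : M →ₗ[(SmashOp E)ᵐᵒᵖ] N) (hp : Function.Injective p)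
    {t : N ⊗[R] C} {m : M} (ht : Represents E t (p m)) : ∃ s : M ⊗[R] C, Represents E s m := by
  obtain ⟨s, rfl⟩ := hC.mem_range_rTensor (hM.linearMap hN p) (t := t) fun g => by
    rw [ht.evalRight, ← map_smul]
    exact ⟨_, rfl⟩
  refine ⟨s, fun f => hp ?_⟩
  rw [map_smul, ← ht f, alphaMap_rTensor E _ (hM.map_alg_smul hN p)]
  rfl

end Compatible

/-- Every element is rational when `C` is finitely generated projective. -/
theorem exists_represents_of_finite_projective [Module.Finite R C] [Module.Projective R C]
    {M : Type u} [AddCommGroup M] [Module R M] [Module Aᵐᵒᵖ M] [Module (SmashOp E)ᵐᵒᵖ M]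
    [IsScalarTower R Aᵐᵒᵖ M] (hM : SmashCompatible E M) (m : M) :
    ∃ t : M ⊗[R] C, Represents E t m := by
  obtain ⟨n, p, q, -, -, hpq⟩ := Module.Finite.exists_comp_eq_id_of_projective R C
  -- `e` and `g` form a dual basis, obtained from a splitting `p ∘ q = id` through a free module.
  let e : Fin n → C := fun i => p (Pi.single i 1)
  let g : Fin n → Module.Dual R C := fun i => LinearMap.proj i ∘ₗ q
  have he : ∀ c, ∑ i, g i c • e i = c := by
    intro c
    conv_rhs => rw [← LinearMap.id_apply (R := R) c, ← hpq, LinearMap.comp_apply,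
      ← LinearMap.sum_single_apply (fun _ : Fin n => R) (q c), map_sum]
    refine Finset.sum_congr rfl fun i _ => ?_
    rw [← map_smul]
    simp [g, ← Pi.single_smul]
  refine ⟨∑ i, (op (ofDual E (g i)) • m) ⊗ₜ e i, fun f => ?_⟩
  -- This is `f = ∑ g_i(-) f(e_i)`; letting both sides act on `m` gives the required formula.
  have hf : f = ∑ i, ofDual E (g i) * ofAlg E (f.toLin (e i)) := by
    refine toLin_ext fun c => ?_
    have hsum : ∀ F : Fin n → SmashOp E, (∑ i, F i).toLin c = ∑ i, (F i).toLin c :=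
      fun F => LinearMap.sum_apply _ _ _
    rw [hsum]
    simp only [ofDual_mul_ofAlg_apply, ← map_smul, ← map_sum, he]
  conv_rhs => rw [hf]
  rw [map_sum, LinearMap.sum_apply, Finset.op_sum, Finset.sum_smul]
  refine Finset.sum_congr rfl fun i _ => ?_
  rw [alphaMap_tmul, hM.alg_smul, op_mul, mul_smul]

/-! ### Entwined modules and rational modules -/

theorem EntwinedModule.op_smul_eq (M : EntwinedModule E) (f : SmashOp E) (m : M) :
    op f • m = alphaMap E M (M.coact m) f := rfl

theorem EntwinedModule.represents_coact (M : EntwinedModule E) (m : M) :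
    Represents E (M.coact m) m := fun _ => rfl

/-- Both identities reduce to the counit axiom: scalars and elements of `A` enter the ring through
`ε`. -/
theorem EntwinedModule.smashCompatible (M : EntwinedModule E) : SmashCompatible E M where
  base_smul r m := by
    have : algebraMap R (SmashOp E)ᵐᵒᵖ r = op (r • (1 : SmashOp E)) := by
      rw [Algebra.algebraMap_eq_smul_one]; rfl
    rw [this, M.op_smul_eq, map_smul, alphaMap_one, M.coact_counit]
  alg_smul a m := by
    rw [M.op_smul_eq]
    have h : ∀ t : M ⊗[R] C, alphaMap E M t (ofAlg E a) =
        op a • TensorProduct.rid R M (CoalgebraStruct.counit.lTensor M t) := by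
      intro t
      induction t with
      | zero => simp
      | add s t hs ht => simp only [map_add, smul_add, LinearMap.add_apply, hs, ht]
      | tmul x y => simp [smul_comm (op a)]
    rw [h, M.coact_counit]

theorem isRational_toSmashModules (M : EntwinedModule E) :
    IsRational E ((toSmashModules E).obj M) :=
  Set.eq_univ_of_forall fun m =>
    (M.smashCompatible.mem_ratPart (M := M) m).2 ⟨_, M.represents_coact E m⟩

section OfRational

variable {E} {M : Type u} [AddCommGroup M] [Module R M] [Module Aᵐᵒᵖ M]
  [Module (SmashOp E)ᵐᵒᵖ M] [IsScalarTower R Aᵐᵒᵖ M]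

/-- The entwined module attached to a rational module. -/
def ofRational (hC : SeparatedByDual R C) (hM : SmashCompatible E M)
    (ρ : M → M ⊗[R] C) (hρ : ∀ m, Represents E (ρ m) m) : EntwinedModule E where
  carrier := M
  coact :=
    { toFun := ρ
      map_add' := fun m n => (hρ _).unique hC ((hρ m).add (hρ n))
      map_smul' := fun r m => (hρ _).unique hC (hM.represents_smul (hρ m) r) }
  coact_coassoc m := by
    let ρ' : M →ₗ[R] M ⊗[R] C :=
      { toFun := ρ
        map_add' := fun m n => (hρ _).unique hC ((hρ m).add (hρ n))
        map_smul' := fun r m => (hρ _).unique hC (hM.represents_smul (hρ m) r) }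
    change TensorProduct.assoc R M C C (ρ'.rTensor C (ρ m)) =
      CoalgebraStruct.comul.lTensor M (ρ m)
    apply (TensorProduct.assoc R M C C).symm.injective
    rw [LinearEquiv.symm_apply_apply]
    -- The two rightmost factors are tested one after the other; both sides then become the action
    -- of `ofDual g * ofDual g'` on `m`.
    refine hC.ext fun g => hC.ext fun g' => ?_
    have h2 : ∀ t : M ⊗[R] C, evalRight M g' (evalRight (M ⊗[R] C) g
        ((TensorProduct.assoc R M C C).symm (CoalgebraStruct.comul.lTensor M t))) =
        evalRight M (g' ∘ₗ evalRight C g ∘ₗ CoalgebraStruct.comul) t := by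
      intro t
      induction t with
      | zero => simp
      | add s t hs ht => simp only [map_add, hs, ht]
      | tmul x y =>
        simp only [LinearMap.lTensor_tmul, evalRight_tmul, LinearMap.comp_apply]
        induction (CoalgebraStruct.comul y : C ⊗[R] C) with
        | zero => simp
        | add s t hs ht => simp only [map_add, tmul_add, add_smul, hs, ht]
        | tmul z w => simp [mul_smul]
    rw [evalRight_rTensor, h2, (hρ m).evalRight, (hρ m).evalRight, ← ofDual_mul_ofDual, op_mul,
      mul_smul]
    exact (hρ _).evalRight g'
  coact_counit m := by
    change TensorProduct.rid R M (CoalgebraStruct.counit.lTensor M (ρ m)) = m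
    rw [← alphaMap_one E, hρ m, op_one, one_smul]
  coact_smul m a := by
    change ρ (op a • m) = twist E M (ρ m ⊗ₜ a)
    -- After evaluation at `g`, both sides are the action of `ofAlg E a * ofDual E g` on `m`.
    refine hC.ext fun g => ?_
    have h : ∀ t : M ⊗[R] C, evalRight M g (twist E M (t ⊗ₜ a)) =
        alphaMap E M t (ofAlg E a * ofDual E g) := by
      intro t
      induction t with
      | zero => simp
      | add s t hs ht => simp only [map_add, add_tmul, LinearMap.add_apply, hs, ht]
      | tmul x y =>
        rw [twist_tmul_tmul, alphaMap_tmul, ofAlg_mul_ofDual_apply]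
        induction E.ψ (y ⊗ₜ a) with
        | zero => simp
        | add s t hs ht => simp only [map_add, MulOpposite.op_add, add_smul, hs, ht]
        | tmul z w => simp
    rw [h, hρ, (hρ _).evalRight, hM.alg_smul, op_mul, mul_smul]

end OfRational

variable {E}

/-- An equality of objects is possible because the entwined module keeps the carrier and addition of
`N`, and its ring action agrees with the given one by the defining property of the representing
tensors. -/
theorem exists_entwinedModule (hC : SeparatedByDual R C) (N : ModuleCat.{u} (SmashOp E)ᵐᵒᵖ)
    (hN : IsRational E N) : ∃ M : EntwinedModule E, (toSmashModules E).obj M = N := by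
  let _ := restrictBase E N
  let _ := restrictAlg E N
  have _ := restrict_isScalarTower E N
  have hcomp := smashCompatible_restrict E N
  have hrep : ∀ m : N, ∃ t : N ⊗[R] C, Represents E t m := fun m =>
    (hcomp.mem_ratPart m).1 (hN ▸ Set.mem_univ m)
  choose ρ hρ using hrep
  refine ⟨ofRational hC hcomp ρ hρ, ?_⟩
  have : smashModule E (ofRational hC hcomp ρ hρ) = (inferInstance : Module (SmashOp E)ᵐᵒᵖ N) :=
    Module.ext' _ _ fun f m => hρ m f.unop
  exact congrArg (fun i => @ModuleCat.of _ _ N _ i) this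

/-- The ring action determines all the data: the `R`-action through `algebraMap`, the `A`-action
through `ofAlg`, and the coaction through `ofDual` and separation. -/
theorem toSmashModules_injective (hC : SeparatedByDual R C) :
    Function.Injective (toSmashModules E).obj := by
  intro M N h
  -- These formulas are recorded before the structures are taken apart, while they can still be
  -- stated for bundled modules.
  have hMb := M.smashCompatible.base_smul
  have hNb := N.smashCompatible.base_smul
  have hMa := M.smashCompatible.alg_smul
  have hNa := N.smashCompatible.alg_smul
  have hMc := fun m => (M.represents_coact E m).evalRight
  have hNc := fun m => (N.represents_coact E m).evalRight
  obtain @⟨M, _, i, j, _, ρ, _, _, _⟩ := M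
  obtain @⟨N, _, i', j', _, ρ', _, _, _⟩ := N
  injection h with h1 h2 h3
  subst h1
  obtain rfl := eq_of_heq h2
  have h4 : ∀ (f : (SmashOp E)ᵐᵒᵖ) (m : M), _ = _ := fun f m =>
    congrArg (fun i : Module (SmashOp E)ᵐᵒᵖ M => i.smul f m) (eq_of_heq h3)
  obtain rfl : i = i' := Module.ext' _ _ fun r m =>
    (hMb r m).trans ((h4 _ m).trans (hNb r m).symm)
  obtain rfl : j = j' := Module.ext' _ _ fun a m =>
    (hMa a.unop m).trans ((h4 _ m).trans (hNa a.unop m).symm)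
  obtain rfl : ρ = ρ' := LinearMap.ext fun m => hC.ext fun g =>
    (hMc m g).trans ((h4 _ m).trans (hNc m g).symm)
  rfl

/-- Colinearity is automatic: both tensors represent the action on the image of `m`. -/
theorem full_toSmashModules (hC : SeparatedByDual R C) : (toSmashModules E).Full where
  map_surjective {M N} p := by
    let q : M →ₗ[(SmashOp E)ᵐᵒᵖ] N := p.hom
    refine ⟨⟨M.smashCompatible.linearMap N.smashCompatible q,
      M.smashCompatible.map_alg_smul N.smashCompatible q, fun m => ?_⟩, rfl⟩
    exact (N.represents_coact E _).unique hC
      ((M.represents_coact E m).map M.smashCompatible N.smashCompatible q)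

instance faithful_toSmashModules : (toSmashModules E).Faithful where
  map_injective h := EntwinedModule.Hom.ext <| LinearMap.ext fun m =>
    congrArg (fun p => p.hom m) h

end Entwining

open SmashOp

/-! ### Adjoint maps for tensor products of pairings. -/

section PairTensor

variable {R : Type u} [CommRing R]
  {X Y Z U V W X₁ X₂ Y₁ Y₂ V₁ V₂ W₁ W₂ : Type u}
  [AddCommGroup X] [Module R X] [AddCommGroup Y] [Module R Y] [AddCommGroup Z] [Module R Z]
  [AddCommGroup U] [Module R U] [AddCommGroup V] [Module R V] [AddCommGroup W] [Module R W]
  [AddCommGroup X₁] [Module R X₁] [AddCommGroup X₂] [Module R X₂]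
  [AddCommGroup Y₁] [Module R Y₁] [AddCommGroup Y₂] [Module R Y₂]
  [AddCommGroup V₁] [Module R V₁] [AddCommGroup V₂] [Module R V₂]
  [AddCommGroup W₁] [Module R W₁] [AddCommGroup W₂] [Module R W₂]

/-- If `φ₁, ψ₁` and `φ₂, ψ₂` are adjoint for the given pairings, so are `φ₁ ⊗ φ₂`, `ψ₁ ⊗ ψ₂`. -/
theorem pairTensor_map {i₁ : X₁ →ₗ[R] Module.Dual R V₁} {i₂ : X₂ →ₗ[R] Module.Dual R V₂}
    {j₁ : Y₁ →ₗ[R] Module.Dual R W₁} {j₂ : Y₂ →ₗ[R] Module.Dual R W₂}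
    {φ₁ : X₂ →ₗ[R] X₁} {ψ₁ : V₁ →ₗ[R] V₂} {φ₂ : Y₂ →ₗ[R] Y₁} {ψ₂ : W₁ →ₗ[R] W₂}
    (h₁ : ∀ x v, i₁ (φ₁ x) v = i₂ x (ψ₁ v)) (h₂ : ∀ y w, j₁ (φ₂ y) w = j₂ y (ψ₂ w))
    (t : X₂ ⊗[R] Y₂) (w : V₁ ⊗[R] W₁) :
    pairTensor i₁ j₁ (TensorProduct.map φ₁ φ₂ t) w =
      pairTensor i₂ j₂ t (TensorProduct.map ψ₁ ψ₂ w) := by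
  induction t with
  | zero => simp
  | add s t hs ht => simp only [map_add, LinearMap.add_apply, hs, ht]
  | tmul x y =>
    induction w with
    | zero => simp
    | add s t hs ht => simp only [map_add, hs, ht]
    | tmul v w => simp [h₁, h₂]

theorem pairTensor_assoc (i : X →ₗ[R] Module.Dual R V) (j : Y →ₗ[R] Module.Dual R W)
    (k : Z →ₗ[R] Module.Dual R U) (t : (X ⊗[R] Y) ⊗[R] Z) (w : V ⊗[R] (W ⊗[R] U)) :
    pairTensor i (pairTensor j k) (TensorProduct.assoc R X Y Z t) w =
      pairTensor (pairTensor i j) k t ((TensorProduct.assoc R V W U).symm w) := by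
  obtain ⟨w, rfl⟩ := (TensorProduct.assoc R V W U).surjective w
  rw [LinearEquiv.symm_apply_apply]
  suffices h : (TensorProduct.assoc R V W U).toLinearMap.dualMap ∘ₗ
      pairTensor i (pairTensor j k) ∘ₗ (TensorProduct.assoc R X Y Z).toLinearMap =
      pairTensor (pairTensor i j) k from
    LinearMap.congr_fun (LinearMap.congr_fun h t) w
  ext
  simp [mul_assoc]

theorem pairTensor_assoc_symm (i : X →ₗ[R] Module.Dual R V) (j : Y →ₗ[R] Module.Dual R W)
    (k : Z →ₗ[R] Module.Dual R U) (t : X ⊗[R] (Y ⊗[R] Z)) (w : (V ⊗[R] W) ⊗[R] U) :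
    pairTensor (pairTensor i j) k ((TensorProduct.assoc R X Y Z).symm t) w =
      pairTensor i (pairTensor j k) t (TensorProduct.assoc R V W U w) := by
  obtain ⟨t, rfl⟩ := (TensorProduct.assoc R X Y Z).surjective t
  rw [pairTensor_assoc, LinearEquiv.symm_apply_apply, LinearEquiv.symm_apply_apply]

end PairTensor

/-! ### The isomorphisms of categories and the subgenerator. -/

section Subgenerated

variable {R A C : Type u} [CommRing R] [Ring A] [Algebra R A] [AddCommGroup C] [Module R C]
  [Coalgebra R C] {E : EntwiningStructure R A C}

theorem isIsoOfCategories_lift_toSmashModules (hC : SeparatedByDual R C) :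
    IsIsoOfCategories ((IsRational E).lift (toSmashModules E) (isRational_toSmashModules E)) := by
  have := full_toSmashModules (E := E) hC
  refine isIsoOfCategories_of_bijective _ ⟨fun M N h => ?_, fun N => ?_⟩
  · exact toSmashModules_injective hC (congrArg ObjectProperty.FullSubcategory.obj h)
  · obtain ⟨M, hM⟩ := exists_entwinedModule hC N.obj N.property
    exact ⟨M, ObjectProperty.FullSubcategory.ext hM⟩

theorem isIsoOfCategories_toSmashModules (hC : SeparatedByDual R C) [Module.Finite R C]
    [Module.Projective R C] : IsIsoOfCategories (toSmashModules E) := by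
  have := full_toSmashModules (E := E) hC
  refine isIsoOfCategories_of_bijective _ ⟨toSmashModules_injective hC, fun N => ?_⟩
  refine exists_entwinedModule hC N (Set.eq_univ_of_forall fun m => ?_)
  let _ := restrictBase E N
  let _ := restrictAlg E N
  have _ := restrict_isScalarTower E N
  have hN := smashCompatible_restrict E N
  exact (hN.mem_ratPart m).2 (exists_represents_of_finite_projective E hN m)

theorem add_mem_ratPart {M : Type u} [AddCommGroup M] [Module (SmashOp E)ᵐᵒᵖ M] {m n : M}
    (hm : m ∈ ratPart E M) (hn : n ∈ ratPart E M) : m + n ∈ ratPart E M := by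
  let _ := restrictBase E M
  let _ := restrictAlg E M
  have _ := restrict_isScalarTower E M
  obtain ⟨s, hs⟩ := hm
  obtain ⟨t, ht⟩ := hn
  exact ⟨s + t, Represents.add hs ht⟩

theorem zero_mem_ratPart {M : Type u} [AddCommGroup M] [Module (SmashOp E)ᵐᵒᵖ M] :
    (0 : M) ∈ ratPart E M := by
  let _ := restrictBase E M
  let _ := restrictAlg E M
  have _ := restrict_isScalarTower E M
  exact ⟨0, represents_zero⟩

theorem map_mem_ratPart {M N : Type u} [AddCommGroup M] [Module (SmashOp E)ᵐᵒᵖ M]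
    [AddCommGroup N] [Module (SmashOp E)ᵐᵒᵖ N] (p : M →ₗ[(SmashOp E)ᵐᵒᵖ] N) {m : M}
    (hm : m ∈ ratPart E M) : p m ∈ ratPart E N := by
  let _ := restrictBase E M
  let _ := restrictAlg E M
  have _ := restrict_isScalarTower E M
  let _ := restrictBase E N
  let _ := restrictAlg E N
  have _ := restrict_isScalarTower E N
  obtain ⟨s, hs⟩ := hm
  exact ⟨_, Represents.map (smashCompatible_restrict E M) (smashCompatible_restrict E N) p hs⟩

theorem mem_ratPart_of_map (hC : SeparatedByDual R C) {M N : Type u} [AddCommGroup M]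
    [Module (SmashOp E)ᵐᵒᵖ M] [AddCommGroup N] [Module (SmashOp E)ᵐᵒᵖ N]
    (p : M →ₗ[(SmashOp E)ᵐᵒᵖ] N) (hp : Function.Injective p) {m : M}
    (hm : p m ∈ ratPart E N) : m ∈ ratPart E M := by
  let _ := restrictBase E M
  let _ := restrictAlg E M
  have _ := restrict_isScalarTower E M
  let _ := restrictBase E N
  let _ := restrictAlg E N
  have _ := restrict_isScalarTower E N
  obtain ⟨s, hs⟩ := hm
  exact Represents.of_map hC (smashCompatible_restrict E M) (smashCompatible_restrict E N) p hp hs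

/-- The image of `n` in `G` lifts to a finitely supported family in `K`, whose entries are rational;
rationality then passes to the sum, to its image, and back along the injection. -/
theorem isRational_of_isSubgeneratedBy (hC : SeparatedByDual R C)
    {K N : ModuleCat.{u} (SmashOp E)ᵐᵒᵖ} (hK : IsRational E K) (hN : IsSubgeneratedBy K N) :
    IsRational E N := by
  obtain ⟨G, ⟨ι, p, hp⟩, i, hi⟩ := hN
  refine Set.eq_univ_of_forall fun n => mem_ratPart_of_map hC i hi ?_
  obtain ⟨k, hk⟩ := hp (i n)
  rw [← hk]
  refine map_mem_ratPart p ?_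
  clear hk
  induction k using Finsupp.induction_linear with
  | zero => exact zero_mem_ratPart
  | add f g hf hg => exact add_mem_ratPart hf hg
  | single j x =>
    exact map_mem_ratPart (Finsupp.lsingle j) (Set.eq_univ_iff_forall.1 hK x)

/-- The coaction of an entwined module `M` as a morphism `M → M ⊗ C`. -/
def coactHom (M : EntwinedModule E) : M ⟶ inducedModule E M where
  toLinearMap := (toInduced E M).toLinearMap ∘ₗ M.coact
  map_smul a m := by
    change toInduced E M (M.coact (op a • m)) = op a • toInduced E M (M.coact m)
    rw [M.coact_smul, smul_toInduced]
  map_coact m := by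
    have h : inducedCoact R C M (M.coact m) = M.coact.rTensor C (M.coact m) := by
      apply (TensorProduct.assoc R M C C).injective
      rw [M.coact_coassoc]
      simp [inducedCoact]
    change (inducedModule E M).coact (toInduced E M (M.coact m)) =
      ((toInduced E M).toLinearMap ∘ₗ M.coact).rTensor C (M.coact m)
    rw [inducedModule_coact, h, LinearMap.rTensor_comp_apply]

/-- The morphism `A ⊗ C → M ⊗ C`, `a ⊗ c ↦ m a ⊗ c`, attached to an element of a right
`A`-module `M`. -/
def actOnHom (M : Type u) [AddCommGroup M] [Module R M] [Module Aᵐᵒᵖ M]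
    [IsScalarTower R Aᵐᵒᵖ M] (m : M) : inducedModule E A ⟶ inducedModule E M where
  toLinearMap := (toInduced E M).toLinearMap ∘ₗ actOn M m ∘ₗ (toInduced E A).symm.toLinearMap
  map_smul a x := by
    obtain ⟨t, rfl⟩ := (toInduced E A).surjective x
    have h : ∀ t : A ⊗[R] C,
        actOn M m (twist E A (t ⊗ₜ a)) = twist E M (actOn M m t ⊗ₜ a) := by
      intro t
      induction t with
      | zero => simp
      | add s t hs ht => simp only [add_tmul, map_add, hs, ht]
      | tmul x y =>
        rw [actOn_tmul, twist_tmul_tmul, twist_tmul_tmul]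
        induction E.ψ (y ⊗ₜ a) with
        | zero => simp
        | add s t hs ht => simp only [map_add, hs, ht]
        | tmul z w => simp [mul_smul]
    change toInduced E M (actOn M m (twist E A (t ⊗ₜ a))) =
      op a • toInduced E M (actOn M m t)
    rw [h, smul_toInduced]
  map_coact x := by
    obtain ⟨t, rfl⟩ := (toInduced E A).surjective x
    have h : ∀ t : A ⊗[R] C, inducedCoact R C M (actOn M m t) =
        (actOn M m).rTensor C (inducedCoact R C A t) := by
      intro t
      induction t with
      | zero => simp
      | add s t hs ht => simp only [map_add, hs, ht]
      | tmul x y =>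
        simp only [actOn_tmul, inducedCoact_tmul]
        induction (CoalgebraStruct.comul y : C ⊗[R] C) with
        | zero => simp
        | add s t hs ht => simp only [tmul_add, map_add, hs, ht]
        | tmul z w => simp
    change (inducedModule E M).coact (toInduced E M (actOn M m t)) =
      ((toInduced E M).toLinearMap ∘ₗ actOn M m ∘ₗ (toInduced E A).symm.toLinearMap).rTensor C
        ((toInduced E A).toLinearMap.rTensor C (inducedCoact R C A t))
    rw [inducedModule_coact, h, ← LinearMap.rTensor_comp_apply, ← LinearMap.rTensor_comp_apply]
    congr 2

theorem isGeneratedBy_inducedModule (M : Type u) [AddCommGroup M] [Module R M] [Module Aᵐᵒᵖ M]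
    [IsScalarTower R Aᵐᵒᵖ M] : IsGeneratedBy ((toSmashModules E).obj (inducedModule E A))
      ((toSmashModules E).obj (inducedModule E M)) := by
  -- One copy of `A ⊗ C` for each `m : M`. The scalars `ℕ` are used since the ring need not be
  -- commutative.
  let p := Finsupp.lsum ℕ fun m : M => ((toSmashModules E).map (actOnHom M m)).hom
  refine ⟨M, p, fun x => ?_⟩
  obtain ⟨t, rfl⟩ := (toInduced E M).surjective x
  induction t with
  | zero => exact ⟨0, by rw [map_zero, map_zero]; rfl⟩
  | add s t hs ht =>
    obtain ⟨a, ha⟩ := hs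
    obtain ⟨b, hb⟩ := ht
    exact ⟨a + b, by rw [map_add, map_add, ha, hb]; rfl⟩
  | tmul m c =>
    -- `m ⊗ c` is the image of `1 ⊗ c` from the copy with index `m`.
    refine ⟨Finsupp.single m (toInduced E A (1 ⊗ₜ c)), ?_⟩
    refine (Finsupp.lsum_single ..).trans ?_
    change toInduced E M (actOn M m (1 ⊗ₜ c)) = _
    rw [actOn_tmul, op_one, one_smul]

/-- The coaction `M → M ⊗ C` is a morphism, and it is injective because the counit splits it. -/
theorem isSubgeneratedBy_of_isRational (hC : SeparatedByDual R C)
    {N : ModuleCat.{u} (SmashOp E)ᵐᵒᵖ} (hN : IsRational E N) :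
    IsSubgeneratedBy ((toSmashModules E).obj (inducedModule E A)) N := by
  obtain ⟨M, rfl⟩ := exists_entwinedModule hC N hN
  refine ⟨_, isGeneratedBy_inducedModule M, ((toSmashModules E).map (coactHom M)).hom,
    fun m n h => ?_⟩
  have h' : M.coact m = M.coact n := (toInduced E M).injective h
  exact (M.coact_counit m).symm.trans ((congrArg _ (congrArg _ h')).trans (M.coact_counit n))

theorem isRational_eq_isSubgeneratedBy (hC : SeparatedByDual R C) :
    IsRational E = IsSubgeneratedBy ((toSmashModules E).obj (inducedModule E A)) :=
  funext fun _ => propext ⟨isSubgeneratedBy_of_isRational hC,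
    isRational_of_isSubgeneratedBy hC (isRational_toSmashModules E _)⟩

theorem alphaCondition_of_separatedByDual (hC : SeparatedByDual R C) : E.AlphaCondition := by
  intro M _ _ _ _
  rw [injective_iff_map_eq_zero]
  intro t ht
  exact hC M t fun g => by rw [← alphaMap_ofDual E, ht, LinearMap.zero_apply]

end Subgenerated

/-! ### The product of `A'` as the adjoint of `Δ_C`. -/

section Convolution

variable {R C : Type u} [CommRing R] [AddCommGroup C] [Module R C] [Coalgebra R C]
  (A' : Subalgebra R (WithConv (C →ₗ[R] R)))

theorem dualAlgIncl_mul' (t : DualAlg A' ⊗[R] DualAlg A') (c : C) :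
    dualAlgIncl A' (LinearMap.mul' R (DualAlg A') t) c =
      pairTensor (dualAlgIncl A') (dualAlgIncl A') t (CoalgebraStruct.comul c) := by
  induction t with
  | zero => simp
  | add s t hs ht => simp only [map_add, LinearMap.add_apply, hs, ht]
  | tmul x y =>
    rw [LinearMap.mul'_apply]
    refine (LinearMap.convMul_apply x.1 y.1 c).trans ?_
    induction (CoalgebraStruct.comul c : C ⊗[R] C) with
    | zero => simp
    | add s t hs ht => simp only [map_add, hs, ht]
    | tmul z w => rw [pairTensor_tmul]; rfl

theorem dualAlgIncl_one (c : C) :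
    dualAlgIncl A' (1 : DualAlg A') c = CoalgebraStruct.counit c := rfl

end Convolution

/-! ### The dual entwining structure. -/

section Dual

variable {R A C : Type u} [CommRing R] [IsNoetherianRing R] [Ring A] [Algebra R A]
  [IsAlphaAlgebra R A] [AddCommGroup C] [Module R C] [Coalgebra R C]
  (E : EntwiningStructure R A C) (A' : Subalgebra R (WithConv (C →ₗ[R] R)))
  (C' : Subcoalgebra R (FiniteDual R A)) (h : DualStable E A' C')

theorem dualCoalg_separated {X : Type u} [AddCommGroup X] [Module R X] {s t : X ⊗[R] C'}
    (hst : ∀ a, evalRight X (LinearMap.applyₗ a ∘ₗ dualCoalgIncl C') s =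
      evalRight X (LinearMap.applyₗ a ∘ₗ dualCoalgIncl C') t) : s = t := by
  rw [← sub_eq_zero]
  refine (dualCoalgIncl_isPureMap C').eq_zero _ fun a => ?_
  exact (map_sub _ _ _).trans (sub_eq_zero.2 (hst a))

/-- Purity in `R^A` enters the module-theoretic half only here: evaluations at points of `A` are
among the functionals on `C'`. -/
theorem separatedByDual_subcoalgebra : SeparatedByDual R C' := fun X _ _ t ht =>
  dualCoalg_separated C' fun a => by rw [ht, map_zero]

/-- Inside `A° ⊗ A°` the comultiplication of `C'` is that of `A°`, which is dual to the product of
`A` by construction. -/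
theorem pairTensor_comul_dualCoalg (f : C') (w : A ⊗[R] A) :
    pairTensor (dualCoalgIncl C') (dualCoalgIncl C') (CoalgebraStruct.comul f) w =
      dualCoalgIncl C' f (LinearMap.mul' R A w) := by
  have h1 : pairTensor (dualCoalgIncl C') (dualCoalgIncl C') (CoalgebraStruct.comul f) =
      finiteDualPair R A (TensorProduct.map C'.incl C'.incl (C'.comul f)) := by
    rw [dualCoalgIncl, pairTensor, TensorProduct.map_comp]
    rfl
  rw [h1, C'.map_incl_comul]
  induction w with
  | zero => simp
  | add s t hs ht => simp only [map_add, hs, ht]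
  | tmul a b => exact finiteDualPair_comul R A _ a b

theorem dualCoalg_counit (f : C') :
    (CoalgebraStruct.counit f : R) = dualCoalgIncl C' f 1 := rfl

theorem pairAC_dualEntwiningMap_apply (t : C' ⊗[R] DualAlg A') (w : C ⊗[R] A) :
    pairAC A' C' (dualEntwiningMap E A' C' h t) w = pairCA A' C' t (E.ψ w) := by
  rw [pairAC_dualEntwiningMap]
  rfl

/-- The transpose of the counit axiom for `ψ`, as the unit of `A'` is `ε_C`. -/
theorem dualEntwiningMap_one (f : C') :
    dualEntwiningMap E A' C' h (f ⊗ₜ 1) = 1 ⊗ₜ f := by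
  refine pairAC_injective A' C' (TensorProduct.ext' fun c a => ?_)
  have h1 : ∀ s : A ⊗[R] C, pairCA A' C' (f ⊗ₜ 1) s =
      dualCoalgIncl C' f (TensorProduct.rid R A (CoalgebraStruct.counit.lTensor A s)) := by
    intro s
    induction s with
    | zero => simp
    | add s t hs ht => simp only [map_add, hs, ht]
    | tmul a c => simp [pairCA, dualAlgIncl_one, mul_comm]
  rw [pairAC_dualEntwiningMap_apply, h1, E.ψ_counit]
  simp [pairAC, dualAlgIncl_one]

/-- The transpose of `ψ_one`, as the counit of `C'` is evaluation at `1`. -/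
theorem counit_dualEntwiningMap (f : C') (g : DualAlg A') :
    TensorProduct.rid R (DualAlg A') (CoalgebraStruct.counit.lTensor (DualAlg A')
      (dualEntwiningMap E A' C' h (f ⊗ₜ g))) = (CoalgebraStruct.counit f : R) • g := by
  refine dualAlgIncl_injective A' (LinearMap.ext fun c => ?_)
  have h1 : ∀ t : DualAlg A' ⊗[R] C', dualAlgIncl A' (TensorProduct.rid R (DualAlg A')
      (CoalgebraStruct.counit.lTensor (DualAlg A') t)) c = pairAC A' C' t (c ⊗ₜ 1) := by
    intro t
    induction t with
    | zero => simp
    | add s t hs ht => simp only [map_add, LinearMap.add_apply, hs, ht]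
    | tmul x y => simp [pairAC, dualCoalg_counit, mul_comm]
  rw [h1, pairAC_dualEntwiningMap_apply, E.ψ_one]
  simp [pairCA, dualCoalg_counit]

/-- The transpose of `ψ_comul`. -/
theorem dualEntwiningMap_mul (f : C') (g g' : DualAlg A') :
    dualEntwiningMap E A' C' h (f ⊗ₜ (g * g')) =
      (LinearMap.mul' R (DualAlg A')).rTensor C' ((TensorProduct.assoc R _ _ _).symm
        ((dualEntwiningMap E A' C' h).lTensor (DualAlg A') (TensorProduct.assoc R _ _ _
          (dualEntwiningMap E A' C' h (f ⊗ₜ g) ⊗ₜ g')))) := by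
  have hφ := pairAC_dualEntwiningMap_apply E A' C' h
  refine pairAC_injective A' C' (TensorProduct.ext' fun c a => ?_)
  have hl : pairCA A' C' (f ⊗ₜ (g * g')) (E.ψ (c ⊗ₜ a)) =
      pairTensor (pairCA A' C') (dualAlgIncl A') ((f ⊗ₜ g) ⊗ₜ g')
        ((TensorProduct.assoc R _ _ _).symm (CoalgebraStruct.comul.lTensor A (E.ψ (c ⊗ₜ a)))) := by
    rw [pairCA, ← pairTensor_assoc]
    exact pairTensor_map (φ₁ := LinearMap.id) (ψ₁ := LinearMap.id) (fun _ _ => rfl)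
      (dualAlgIncl_mul' A') (f ⊗ₜ (g ⊗ₜ g')) _
  have hr := pairTensor_map (φ₂ := LinearMap.id) (ψ₂ := LinearMap.id) (dualAlgIncl_mul' A')
      (j₁ := dualCoalgIncl C') (j₂ := dualCoalgIncl C') (fun _ _ => rfl)
  -- The product `g * g'` has become `Δ_C` after `ψ`, to which `ψ_comul` applies. On the right-hand
  -- side, the product and then each `φ` are moved across the pairing.
  rw [hφ, hl, E.ψ_comul, LinearEquiv.symm_apply_apply]
  refine Eq.trans ?_ (hr _ _).symm
  rw [pairTensor_assoc_symm]
  refine Eq.trans ?_ (pairTensor_map (φ₁ := LinearMap.id) (ψ₁ := LinearMap.id) (fun _ _ => rfl)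
    hφ _ _).symm
  rw [pairCA, pairTensor_assoc]
  exact (pairTensor_map (φ₂ := LinearMap.id) (ψ₂ := LinearMap.id) hφ (fun _ _ => rfl)
    ((f ⊗ₜ g) ⊗ₜ g') _).symm

/-- The transpose of `ψ_mul`, checked in the dual of `(C ⊗ A) ⊗ A`, where the pairing is faithful by
purity of `C'`. -/
theorem comul_dualEntwiningMap (f : C') (g : DualAlg A') :
    CoalgebraStruct.comul.lTensor (DualAlg A') (dualEntwiningMap E A' C' h (f ⊗ₜ g)) =
      TensorProduct.assoc R _ _ _ ((dualEntwiningMap E A' C' h).rTensor C'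
        ((TensorProduct.assoc R _ _ _).symm ((dualEntwiningMap E A' C' h).lTensor C'
          (TensorProduct.assoc R _ _ _ (CoalgebraStruct.comul f ⊗ₜ g))))) := by
  have hφ := pairAC_dualEntwiningMap_apply E A' C' h
  apply (TensorProduct.assoc R _ _ _).symm.injective
  rw [LinearEquiv.symm_apply_apply]
  apply pairTensor_injective _ _ (pairAC_injective A' C') (dualCoalgIncl_isPureMap C')
  refine TensorProduct.ext_threefold fun c a b => ?_
  have hl := pairTensor_map (φ₁ := LinearMap.id) (ψ₁ := LinearMap.id) (i₁ := dualAlgIncl A')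
    (fun _ _ => rfl) (pairTensor_comul_dualCoalg C') (dualEntwiningMap E A' C' h (f ⊗ₜ g))
    (TensorProduct.assoc R _ _ _ ((c ⊗ₜ a) ⊗ₜ b))
  have hr := pairTensor_map (φ₂ := LinearMap.id) (ψ₂ := LinearMap.id)
    (pairTensor_comul_dualCoalg C') (j₁ := dualAlgIncl A') (fun _ _ => rfl) (f ⊗ₜ g)
    ((TensorProduct.assoc R A A C).symm
      (E.ψ.lTensor A (TensorProduct.assoc R A C A (E.ψ (c ⊗ₜ a) ⊗ₜ b))))
  -- `ψ_mul` restated with `TensorProduct.map` and identities, the form in which `pairTensor_map`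
  -- delivers the adjoints.
  have hm : E.ψ (TensorProduct.map LinearMap.id (LinearMap.mul' R A)
      (TensorProduct.assoc R C A A ((c ⊗ₜ a) ⊗ₜ b))) =
      TensorProduct.map (LinearMap.mul' R A) LinearMap.id ((TensorProduct.assoc R A A C).symm
        (E.ψ.lTensor A (TensorProduct.assoc R A C A (E.ψ (c ⊗ₜ a) ⊗ₜ b)))) :=
    E.ψ_mul c a b
  refine ((pairTensor_assoc_symm _ _ _ _ _).trans (hl.trans (hφ _ _))).trans ?_
  rw [hm]
  refine (hr.symm.trans (pairTensor_assoc _ _ _ _ _).symm).trans ?_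
  refine (pairTensor_map (φ₁ := LinearMap.id) (ψ₁ := LinearMap.id) (fun _ _ => rfl)
    hφ _ _).symm.trans ?_
  refine (pairTensor_assoc_symm _ _ _ _ _).symm.trans ?_
  exact (pairTensor_map (φ₂ := LinearMap.id) (ψ₂ := LinearMap.id) hφ (fun _ _ => rfl)
    _ ((c ⊗ₜ a) ⊗ₜ b)).symm

/-- The entwining structure `(A', C', φ)` dual to `(A, C, ψ)`. -/
def dualEntwining : EntwiningStructure R (DualAlg A') C' where
  ψ := dualEntwiningMap E A' C' h
  ψ_mul := dualEntwiningMap_mul E A' C' h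
  ψ_one := dualEntwiningMap_one E A' C' h
  ψ_comul := comul_dualEntwiningMap E A' C' h
  ψ_counit := counit_dualEntwiningMap E A' C' h

end Dual
end

end DualEntwining

theorem mainTheorem1 {R A C : Type u} [CommRing R] [IsNoetherianRing R]
    [Ring A] [Algebra R A] [IsAlphaAlgebra R A]
    [AddCommGroup C] [Module R C] [Coalgebra R C]
    (E : EntwiningStructure R A C)
    (A' : Subalgebra R (WithConv (C →ₗ[R] R)))
    (C' : Subcoalgebra R (FiniteDual R A))
    (h : DualStable E A' C') :
    ∃ E' : EntwiningStructure R (DualAlg A') C', E'.ψ = dualEntwiningMap E A' C' h ∧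
      E'.AlphaCondition ∧
      (∃ hrat : ∀ M : EntwinedModule E', IsRational E' ((toSmashModules E').obj M),
        IsIsoOfCategories ((IsRational E').lift (toSmashModules E') hrat)) ∧
      IsRational E' = IsSubgeneratedBy ((toSmashModules E').obj (inducedModule E' (DualAlg A'))) ∧
      (Module.Finite R C' → Module.Projective R C' →
        IsIsoOfCategories (toSmashModules E')) := by
  have hC := separatedByDual_subcoalgebra C'
  exact ⟨dualEntwining E A' C' h, rfl, alphaCondition_of_separatedByDual hC,
    ⟨isRational_toSmashModules _, isIsoOfCategories_lift_toSmashModules hC⟩,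
    isRational_eq_isSubgeneratedBy hC, fun _ _ => isIsoOfCategories_toSmashModules hC⟩
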